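/- Let $a<b$ be real, let $\alpha,\beta\in\mathbb{C}$ with $\Re\alpha\ge 0$, $\alpha\neq 0$, $\Re\beta>0$, and put $m=\lfloor\Re\alpha\rfloor+1$. Let $\varphi\in C^m[a,b]$ be real-valued with $\varphi'>0$ on $[a,b]$ (so $\varphi$ is Lipschitz continuous), and let $R>(\varphi(b)-\varphi(a))^{\Re\beta}$; if $L$ is a Lipschitz constant of $\varphi$, it suffices that $R>(L(b-a))^{\Re\beta}$. Let $\mathcal{A}(z)=\sum_{n\ge0}a_nz^n$ be analytic on the disc $|z|<R$ (the $a_n$ may depend on $\alpha,\beta$), with $a_0\neq0$. Let $\overline{\mathcal{A}}(z)=\sum_{n\ge0}\overline{a}_nz^n$ be defined by $\mathcal{A}_\Gamma\cdot\overline{\mathcal{A}}_\Gamma=1$ as formal power series, where $$\mathcal{A}_\Gamma(z)=\sum_{n\ge0}a_n\Gamma(\beta n+\alpha)z^n,\qquad \overline{\mathcal{A}}_\Gamma(z)=\sum_{n\ge0}\overline{a}_n\Gamma(\beta n+m-\alpha)z^n,$$ and assume that $\overline{\mathcal{A}}$ is analytic on $|z|<R$ as well. Let $u\in L^1[a,b]$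 be complex-valued and $m$ times continuously differentiable on $(a,b]$ (for example $u\in C^m[a,b]$). Write $\frac{\mathrm d}{\mathrm d\varphi(x)}=\frac{1}{\varphi'(x)}\frac{\mathrm d}{\mathrm dx}$, with one-sided derivatives at $b$. For $\Re\gamma>0$ put $${}_aI^{\gamma}_{\varphi(x)}u(x)=\frac1{\Gamma(\gamma)}\int_a^x\varphi'(t)\,(\varphi(x)-\varphi(t))^{\gamma-1}u(t)\,\mathrm dt .$$ For $\delta\in\mathbb{C}$ put ${}_aD^{\delta}_{\varphi(x)}u=\left(\frac{\mathrm d}{\mathrm d\varphi(x)}\right)^{k}{}_aI^{k-\delta}_{\varphi(x)}u$ with $k=\lfloor\Re\delta\rfloor+1$ if $\Re\delta\ge0$, and ${}_aD^{\delta}_{\varphi(x)}u={}_aI^{-\delta}_{\varphi(x)}u$ if $\Re\delta<0$. Let the generalised derivative of Riemann--Liouville type be $${}^{\mathcal{A}_R}_{\;\;a}D^{\alpha,\beta}_{\varphi(x)}u(x)=\left(\frac{\mathrm d}{\mathrm d\varphi(x)}\right)^{m}\int_a^x\varphi'(t)\,(\varphi(x)-\varphi(t))^{m-\alpha-1}\,\overline{\mathcal{A}}\big((\varphi(x)-\varphi(t))^{\beta}\big)\,u(t)\,\mathrm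 dt .$$ Then on $(a,b]$ the generalised derivative ${}^{\mathcal{A}_R}_{\;\;a}D^{\alpha,\beta}_{\varphi(x)}u$ and all ${}_aD^{\alpha-\beta n}_{\varphi(x)}u$, $n\ge0$, exist (all the integrals converge absolutely and all the derivatives exist), and $${}^{\mathcal{A}_R}_{\;\;a}D^{\alpha,\beta}_{\varphi(x)}u(x)=\sum_{n=0}^{\infty}\overline{a}_n\,\Gamma(\beta n-\alpha+m)\;{}_aD^{\alpha-\beta n}_{\varphi(x)}u(x),$$ where the series converges (unconditionally and) locally uniformly on $(a,b]$. -/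

import Mathlib

open Set MeasureTheory

noncomputable section

namespace AnalyticKernelCalculus

/-! Throughout, `a b : ℝ` are the endpoints of the interval, `φ : ℝ → ℝ` is the function with respect
to which one integrates and differentiates, and `u : ℝ → ℂ` is the function acted upon. All
derivatives are derivatives within `[a,b]` (so one-sided at the endpoint `b`). -/

/-- The operator `(1/φ'(x)) · d/dx`. -/
def phiDeriv (a b : ℝ) (φ : ℝ → ℝ) (f : ℝ → ℂ) (x : ℝ) : ℂ :=
  ((derivWithin φ (Icc a b) x : ℝ) : ℂ)⁻¹ * derivWithin f (Icc a b) x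

/-- `f` can be differentiated `m` times by `(1/φ'(x)) · d/dx` on `(a,b]`. -/
def PhiDifferentiable (a b : ℝ) (φ : ℝ → ℝ) (m : ℕ) (f : ℝ → ℂ) : Prop :=
  ∀ k < m, DifferentiableOn ℝ ((phiDeriv a b φ)^[k] f) (Ioc a b)

/-! ### Riemann–Liouville operators with respect to `φ` -/

/-- The integrand `φ'(t) (φ(x) - φ(t))^(γ-1) u(t)`. -/
def rlIntegrand (a b : ℝ) (φ : ℝ → ℝ) (γ : ℂ) (u : ℝ → ℂ) (x t : ℝ) : ℂ :=
  ((derivWithin φ (Icc a b) t : ℝ) : ℂ) * ((φ x - φ t : ℝ) : ℂ) ^ (γ - 1) * u t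

/-- The Riemann–Liouville integral of order `γ` (meant for `0 < Re γ`) with respect to `φ`. -/
def rlIntegral (a b : ℝ) (φ : ℝ → ℝ) (γ : ℂ) (u : ℝ → ℂ) (x : ℝ) : ℂ :=
  (Complex.Gamma γ)⁻¹ * ∫ t in a..x, rlIntegrand a b φ γ u x t

/-- The number `⌊Re δ⌋ + 1` of derivatives used in a derivative of order `δ`, `0 ≤ Re δ`. -/
def derivOrder (δ : ℂ) : ℕ := ⌊δ.re⌋₊ + 1

/-- The Riemann–Liouville differintegral of order `δ ∈ ℂ` with respect to `φ`: for `0 ≤ Re δ` it is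
the fractional derivative, for `Re δ < 0` the fractional integral of order `-δ`. -/
def rlDeriv (a b : ℝ) (φ : ℝ → ℝ) (δ : ℂ) (u : ℝ → ℂ) : ℝ → ℂ :=
  if 0 ≤ δ.re then
    (phiDeriv a b φ)^[derivOrder δ] (rlIntegral a b φ ((derivOrder δ : ℂ) - δ) u)
  else rlIntegral a b φ (-δ) u

/-- On `(a,b]` all integrals and derivatives in the definition of `rlDeriv a b φ δ u` exist. -/
def RlDerivExists (a b : ℝ) (φ : ℝ → ℝ) (δ : ℂ) (u : ℝ → ℂ) : Prop :=
  if 0 ≤ δ.re then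
    (∀ x ∈ Ioc a b,
      IntervalIntegrable (rlIntegrand a b φ ((derivOrder δ : ℂ) - δ) u x) volume a x) ∧
    PhiDifferentiable a b φ (derivOrder δ) (rlIntegral a b φ ((derivOrder δ : ℂ) - δ) u)
  else ∀ x ∈ Ioc a b, IntervalIntegrable (rlIntegrand a b φ (-δ) u x) volume a x

/-! ### Analytic kernels, given by their power series at `0` -/

/-- The power series `A` converges on the open disc `D(0,R)`, i.e. it defines an analytic function
there. -/
def ConvergesOnDisc (A : PowerSeries ℂ) (R : ℝ) : Prop :=
  ∀ z ∈ Metric.ball (0 : ℂ) R, Summable fun n : ℕ => PowerSeries.coeff n A * z ^ n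

/-- The sum `A(z) = ∑ aₙ zⁿ`. -/
def kernelEval (A : PowerSeries ℂ) (z : ℂ) : ℂ :=
  ∑' n : ℕ, PowerSeries.coeff n A * z ^ n

/-- The transformed series `A_Γ = ∑ aₙ Γ(β n + α) Xⁿ`. It is a formal power series, because its
radius of convergence can be `0` although `A` is analytic. -/
def gammaTransform (α β : ℂ) (A : PowerSeries ℂ) : PowerSeries ℂ :=
  PowerSeries.mk fun n => PowerSeries.coeff n A * Complex.Gamma (β * n + α)

/-- The conjugate kernel `Ā` of `A` for derivatives of order `α`: its coefficients are determined by
`A_Γ * Ā_Γ = 1`. As `Ā` is the kernel of an integral of order `m - α`, where `m = ⌊Re α⌋ + 1`, the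
transform `Ā_Γ` is taken with the parameters `m - α, β`. -/
def conjKernel (α β : ℂ) (A : PowerSeries ℂ) : PowerSeries ℂ :=
  PowerSeries.mk fun n =>
    PowerSeries.coeff n (gammaTransform α β A)⁻¹ /
      Complex.Gamma (β * n + ((derivOrder α : ℂ) - α))

theorem gamma_conj_ne_zero {α β : ℂ} (hβ : 0 < β.re) (n : ℕ) :
    Complex.Gamma (β * n + ((derivOrder α : ℂ) - α)) ≠ 0 := by
  apply Complex.Gamma_ne_zero_of_re_pos
  have h1 : α.re < (derivOrder α : ℝ) := by
    simpa [derivOrder] using Nat.lt_floor_add_one α.re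
  have h2 : 0 ≤ β.re * (n : ℝ) := by positivity
  simp
  linarith

/-- The defining equation of the conjugate kernel. -/
theorem gammaTransform_mul_conjKernel {α β : ℂ} {A : PowerSeries ℂ} (hα : 0 ≤ α.re)
    (hα0 : α ≠ 0) (hβ : 0 < β.re) (hA0 : PowerSeries.constantCoeff A ≠ 0) :
    gammaTransform α β A *
      gammaTransform ((derivOrder α : ℂ) - α) β (conjKernel α β A) = 1 := by
  have h1 : gammaTransform ((derivOrder α : ℂ) - α) β (conjKernel α β A)
      = (gammaTransform α β A)⁻¹ := by
    ext n
    simp only [gammaTransform, conjKernel, PowerSeries.coeff_mk]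
    exact div_mul_cancel₀ _ (gamma_conj_ne_zero hβ n)
  rw [h1]
  apply PowerSeries.mul_inv_cancel
  have h2 : PowerSeries.constantCoeff (gammaTransform α β A)
      = PowerSeries.constantCoeff A * Complex.Gamma α := by
    rw [← PowerSeries.coeff_zero_eq_constantCoeff_apply, gammaTransform, PowerSeries.coeff_mk]
    simp
  rw [h2]
  refine mul_ne_zero hA0 (Complex.Gamma_ne_zero fun k hk => ?_)
  have h3 : (k : ℝ) = 0 := by
    have h4 := congrArg Complex.re hk
    simp at h4
    have h5 : (0 : ℝ) ≤ k := by positivity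
    linarith
  apply hα0
  rw [hk]
  have h6 : k = 0 := by exact_mod_cast h3
  simp [h6]

/-- The defining equation determines the conjugate kernel. -/
theorem eq_conjKernel {α β : ℂ} {A B : PowerSeries ℂ} (hβ : 0 < β.re)
    (h : gammaTransform α β A * gammaTransform ((derivOrder α : ℂ) - α) β B = 1) :
    B = conjKernel α β A := by
  have hu : PowerSeries.constantCoeff (gammaTransform α β A) ≠ 0 := by
    intro h0
    have h1 := congrArg PowerSeries.constantCoeff h
    rw [map_mul, h0] at h1
    simp at h1
  have h2 : gammaTransform ((derivOrder α : ℂ) - α) β B = (gammaTransform α β A)⁻¹ := by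
    rw [PowerSeries.eq_inv_iff_mul_eq_one hu, mul_comm, h]
  ext n
  rw [conjKernel, PowerSeries.coeff_mk, ← h2, gammaTransform, PowerSeries.coeff_mk,
    mul_div_cancel_right₀ _ (gamma_conj_ne_zero hβ n)]

/-! ### Operators with analytic kernel with respect to `φ` -/

/-- The integrand `φ'(t) (φ(x) - φ(t))^(γ-1) B((φ(x) - φ(t))^β) u(t)`. -/
def genIntegrand (a b : ℝ) (φ : ℝ → ℝ) (B : PowerSeries ℂ) (γ β : ℂ) (u : ℝ → ℂ) (x t : ℝ) : ℂ :=
  ((derivWithin φ (Icc a b) t : ℝ) : ℂ) * ((φ x - φ t : ℝ) : ℂ) ^ (γ - 1) *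
    kernelEval B (((φ x - φ t : ℝ) : ℂ) ^ β) * u t

/-- The generalised fractional integral with analytic kernel `B` and parameters `γ, β`. -/
def genIntegral (a b : ℝ) (φ : ℝ → ℝ) (B : PowerSeries ℂ) (γ β : ℂ) (u : ℝ → ℂ) (x : ℝ) : ℂ :=
  ∫ t in a..x, genIntegrand a b φ B γ β u x t

/-- The generalised fractional derivative of Riemann–Liouville type with analytic kernel `A`:
`((1/φ'(x)) d/dx)^m` applied to the generalised integral with kernel `Ā` and parameters
`m - α, β`, where `m = ⌊Re α⌋ + 1`. -/
def genDeriv (a b : ℝ) (φ : ℝ → ℝ) (A : PowerSeries ℂ) (α β : ℂ) (u : ℝ → ℂ) : ℝ → ℂ :=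
  (phiDeriv a b φ)^[derivOrder α]
    (genIntegral a b φ (conjKernel α β A) ((derivOrder α : ℂ) - α) β u)

/-- On `(a,b]` all integrals and derivatives in the definition of `genDeriv a b φ A α β u` exist. -/
def GenDerivExists (a b : ℝ) (φ : ℝ → ℝ) (A : PowerSeries ℂ) (α β : ℂ) (u : ℝ → ℂ) : Prop :=
  (∀ x ∈ Ioc a b, IntervalIntegrable
    (genIntegrand a b φ (conjKernel α β A) ((derivOrder α : ℂ) - α) β u x) volume a x) ∧
  PhiDifferentiable a b φ (derivOrder α)
    (genIntegral a b φ (conjKernel α β A) ((derivOrder α : ℂ) - α) β u)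

end AnalyticKernelCalculus

end

/-! In the variable `y = φ x` the operator `(1/φ') d/dx` becomes `d/dy`, and all integrals involved
become convolutions on `[p,q] = [φ a, φ b]` of `v = u ∘ φ⁻¹` with a kernel: `r^(γ-1) Ā(r^β)` with `γ
= m - α` for the generalised integral, and the powers `r^(γ+βn-1)` for its terms. The claim is thus
that `d^m/dy^m` may be applied term by term to a convolution with a series of kernels.

Neither factor can take all the derivatives: the derivatives of the kernel need not be integrable at
`r = 0`, and `v` is smooth only on `(p,q]`. So the integral is cut at a point `c` between `p` and
`y`. On `[p,c]` the argument `y - s` stays away from `0` and the kernel is differentiated; on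
`[c,y]` the derivatives fall on `v`, at the price of boundary terms at `c`. The result is the
explicit formula `convDeriv`, which is linear in the kernel
(`SmoothKernel.convDeriv_hasDerivWithinAt`).

In this formula derivatives of the kernel occur only away from `0`, and near `0` only the kernel
itself occurs. Hence the Weierstrass test needs two things: summable bounds for every derivative
away from `0`, and a summable multiple of one integrable function near `0`. Both follow from
`norm_seriesTerm_le`: the factors polynomial in `n` that come from differentiation are harmless
because the inequality for `R` is strict. This gives uniform convergence to the right of every `c' >
c`.

It remains to identify the terms. The Gamma factor cancels the normalisation of the integral of
order `m - (α - βn)`, and the derivatives beyond those in the definition of `rlDeriv` are absorbed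
by `D I^(γ+1) = I^γ` (`phiDeriv_rlIntegral`). -/

noncomputable section

namespace AnalyticKernelCalculus

open Filter Topology

/-! ### Derivatives of convolutions with a kernel that is singular at `0` -/

/-- `K 0` is an integrable smooth kernel on `(0,ρ)`, and `K k` is its `k`-th derivative. -/
structure SmoothKernel (K : ℕ → ℝ → ℂ) (ρ : ℝ) : Prop where
  hasDerivAt : ∀ k, ∀ r ∈ Ioo 0 ρ, HasDerivAt (K k) (K (k + 1) r) r
  integrableOn : IntegrableOn (K 0) (Ioo 0 ρ)

namespace SmoothKernel

variable {K : ℕ → ℝ → ℂ} {ρ : ℝ}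

theorem continuousOn (hK : SmoothKernel K ρ) (k : ℕ) : ContinuousOn (K k) (Ioo 0 ρ) :=
  fun r hr => (hK.hasDerivAt k r hr).continuousAt.continuousWithinAt

theorem integrableOn_Ioc (hK : SmoothKernel K ρ) {l : ℝ} (hl : l < ρ) :
    IntegrableOn (K 0) (Ioc 0 l) :=
  hK.integrableOn.mono_set fun _ hr => ⟨hr.1, hr.2.trans_lt hl⟩

theorem intervalIntegrable (hK : SmoothKernel K ρ) {l : ℝ} (h0 : 0 ≤ l) (hl : l < ρ) :
    IntervalIntegrable (K 0) volume 0 l :=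
  (intervalIntegrable_iff_integrableOn_Ioc_of_le h0).2 (hK.integrableOn_Ioc hl)

theorem intervalIntegrable_reflect (hK : SmoothKernel K ρ) {c y : ℝ} (h0 : c ≤ y)
    (hl : y - c < ρ) : IntervalIntegrable (fun s => K 0 (y - s)) volume c y := by
  have h := (hK.intervalIntegrable (sub_nonneg.2 h0) hl).comp_sub_left y
  simpa using h.symm

theorem near_intervalIntegrable (hK : SmoothKernel K ρ) {c y : ℝ} (h0 : c ≤ y) (hl : y - c < ρ)
    {w : ℝ → ℂ} (hw : ContinuousOn w (Icc c y)) :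
    IntervalIntegrable (fun s => K 0 (y - s) * w s) volume c y :=
  (hK.intervalIntegrable_reflect h0 hl).mul_continuousOn (by rwa [uIcc_of_le h0])

theorem far_continuousOn (hK : SmoothKernel K ρ) (k : ℕ) {p c y : ℝ} (hc : c < y)
    (hy : y - p < ρ) : ContinuousOn (fun s => K k (y - s)) (Icc p c) :=
  (hK.continuousOn k).comp (by fun_prop) fun s hs => ⟨by linarith [hs.2], by linarith [hs.1]⟩

theorem far_intervalIntegrable (hK : SmoothKernel K ρ) (k : ℕ) {p c y : ℝ} (hpc : p ≤ c)
    (hc : c < y) (hy : y - p < ρ) {w : ℝ → ℂ} (hw : IntervalIntegrable w volume p c) :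
    IntervalIntegrable (fun s => K k (y - s) * w s) volume p c :=
  hw.continuousOn_mul (by rw [uIcc_of_le hpc]; exact hK.far_continuousOn k hc hy)

/-- For `s ≤ c` and `y` in a small neighbourhood to the right of `c`, `y - s` stays in a compact
part of `(0,ρ)`. There the next derivative of the kernel is bounded, so a multiple of `‖w‖`
dominates. -/
theorem far_hasDerivAt (hK : SmoothKernel K ρ) (k : ℕ) {p c y : ℝ} (hpc : p ≤ c)
    (hc : c < y) (hy : y - p < ρ) {w : ℝ → ℂ} (hw : IntervalIntegrable w volume p c) :
    HasDerivAt (fun y => ∫ s in p..c, K k (y - s) * w s)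
      (∫ s in p..c, K (k + 1) (y - s) * w s) y := by
  obtain ⟨l, hl1, hl2⟩ := exists_between hc
  obtain ⟨u, hu1, hu2⟩ := exists_between (show y < ρ + p by linarith)
  have hsub : Icc (l - c) (u - p) ⊆ Ioo 0 ρ := fun r hr =>
    ⟨by linarith [hr.1], by linarith [hr.2]⟩
  obtain ⟨M, hM⟩ := isCompact_Icc.exists_bound_of_continuousOn ((hK.continuousOn (k + 1)).mono hsub)
  have hmem : ∀ s ∈ uIoc p c, ∀ z ∈ Ioo l u, z - s ∈ Icc (l - c) (u - p) := by
    intro s hs z hz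
    rw [uIoc_of_le hpc] at hs
    exact ⟨by linarith [hs.2, hz.1], by linarith [hs.1, hz.2]⟩
  refine (intervalIntegral.hasDerivAt_integral_of_dominated_loc_of_deriv_le
    (F' := fun y s => K (k + 1) (y - s) * w s) (bound := fun s => M * ‖w s‖)
    (Ioo_mem_nhds hl2 hu1) ?_ (hK.far_intervalIntegrable k hpc hc hy hw) ?_ ?_
    (hw.norm.const_mul M) ?_).2
  · filter_upwards [Ioo_mem_nhds hl2 hu1] with z hz
    exact (hK.far_intervalIntegrable k hpc (hl1.trans hz.1) (by linarith [hz.2])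
      hw).def'.aestronglyMeasurable
  · exact (hK.far_intervalIntegrable (k + 1) hpc hc hy hw).def'.aestronglyMeasurable
  · filter_upwards with s hs z hz
    rw [norm_mul]
    exact mul_le_mul_of_nonneg_right (hM _ (hmem s hs z hz)) (norm_nonneg _)
  · filter_upwards with s hs z hz
    have h := (hK.hasDerivAt k (z - s) (hsub (hmem s hs z hz))).scomp z
      ((hasDerivAt_id z).sub_const s)
    simpa using h.mul_const (w s)

/-- The substitution `r = y - s` moves `y` from the singular kernel into `w`. The constant `w c` is
split off and yields the boundary term by the fundamental theorem of calculus; the rest vanishes at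
`c`, so it extends by zero to a Lipschitz function and the limits of integration can be frozen. -/
theorem near_hasDerivWithinAt (hK : SmoothKernel K ρ) {c q : ℝ} (hq : q - c < ρ)
    {w w' : ℝ → ℂ} (hw : ∀ s ∈ Icc c q, HasDerivWithinAt w (w' s) (Icc c q) s)
    (hw' : ContinuousOn w' (Icc c q)) {y : ℝ} (hy : y ∈ Ioc c q) :
    HasDerivWithinAt (fun y => ∫ s in c..y, K 0 (y - s) * w s)
      (K 0 (y - c) * w c + ∫ s in c..y, K 0 (y - s) * w' s) (Icc c q) y := by
  have hcq : c ≤ q := hy.1.le.trans hy.2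
  -- A bounded continuous extension of `w'` to the line, so that its primitive `W` is defined and
  -- Lipschitz everywhere.
  set e : ℝ → ℂ := IccExtend hcq ((Icc c q).domRestrict w') with he
  have hec : Continuous e := hw'.domRestrict.Icc_extend'
  have hee : ∀ s ∈ Icc c q, e s = w' s := fun s hs => by
    rw [he, IccExtend_of_mem _ _ hs]; rfl
  obtain ⟨M, hM⟩ := isCompact_Icc.exists_bound_of_continuousOn hw'
  have heM : ∀ s, ‖e s‖ ≤ M := fun s => hM _ (projIcc c q hcq s).2
  have hM0 : 0 ≤ M := (norm_nonneg _).trans (heM c)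
  set W : ℝ → ℂ := fun s => ∫ t in c..s, e t with hWdef
  have hW : ∀ s, HasDerivAt W (e s) s := fun s =>
    intervalIntegral.integral_hasDerivAt_right (hec.intervalIntegrable _ _)
      hec.aestronglyMeasurable.stronglyMeasurableAtFilter hec.continuousAt
  have hWc : W c = 0 := by simp [hWdef]
  have hWw : ∀ s ∈ Icc c q, w s = w c + W s := by
    intro s hs
    have h := intervalIntegral.integral_eq_sub_of_hasDeriv_right_of_le (f := w) (f' := e) hs.1
      (fun t ht => ((hw t ⟨ht.1, ht.2.trans hs.2⟩).continuousWithinAt).mono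
        (Icc_subset_Icc_right hs.2))
      (fun t ht => by
        rw [hee t ⟨ht.1.le, ht.2.le.trans hs.2⟩]
        exact ((hw t ⟨ht.1.le, ht.2.le.trans hs.2⟩).hasDerivAt
          (Icc_mem_nhds ht.1 (ht.2.trans_le hs.2))).hasDerivWithinAt)
      (hec.intervalIntegrable _ _)
    simp only [hWdef, h]; ring
  -- As `W c = 0`, this is `W` continued by zero to the left of `c`. It may have a kink at `c`, and
  -- `d0` is its derivative elsewhere.
  set w0 : ℝ → ℂ := fun s => W (max s c) with hw0
  have hLip : LipschitzWith (Real.toNNReal M) w0 := by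
    have h1 : LipschitzWith (Real.toNNReal M) W :=
      lipschitzWith_of_nnnorm_deriv_le (fun s => (hW s).differentiableAt) fun s => by
        rw [(hW s).deriv, ← NNReal.coe_le_coe, Real.coe_toNNReal _ hM0]
        exact heM s
    have h2 := h1.comp (LipschitzWith.id.max_const c)
    rwa [mul_one] at h2
  have hcw0 : Continuous w0 := hLip.continuous
  set d0 : ℝ → ℂ := fun s => if c < s then e s else 0 with hd0
  have hd0m : Measurable d0 := Measurable.ite measurableSet_Ioi hec.measurable measurable_const
  have hw0d : ∀ s, s ≠ c → HasDerivAt w0 (d0 s) s := by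
    intro s hs
    rcases lt_or_gt_of_ne hs with h | h
    · have : w0 =ᶠ[𝓝 s] fun _ => W c := by
        filter_upwards [Iio_mem_nhds h] with t ht
        simp [hw0, max_eq_right (le_of_lt (mem_Iio.1 ht))]
      simp only [hd0, if_neg h.not_gt]
      exact (hasDerivAt_const s (W c)).congr_of_eventuallyEq this
    · have : w0 =ᶠ[𝓝 s] W := by
        filter_upwards [Ioi_mem_nhds h] with t ht
        simp [hw0, max_eq_left (le_of_lt (mem_Ioi.1 ht))]
      simp only [hd0, if_pos h]
      exact (hW s).congr_of_eventuallyEq this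
  have hL : 0 ≤ q - c := sub_nonneg.2 hcq
  have hK0 : IntervalIntegrable (K 0) volume 0 (q - c) := hK.intervalIntegrable hL hq
  have hKm : AEStronglyMeasurable (K 0) (volume.restrict (Ioc 0 (q - c))) :=
    (hK.integrableOn_Ioc hq).aestronglyMeasurable
  -- the function, written with fixed limits of integration
  have key : ∀ z ∈ Icc c q, ∀ g : ℝ → ℂ, (∀ s ≤ c, g s = 0) →
      ∫ r in Ioc 0 (q - c), K 0 r * g (z - r) = ∫ s in c..z, K 0 (z - s) * g s := by
    intro z hz g hg
    have h1 : ∫ s in c..z, K 0 (z - s) * g s = ∫ r in (0:ℝ)..(z - c), K 0 r * g (z - r) := by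
      have := intervalIntegral.integral_comp_sub_left (a := c) (b := z)
        (fun r => K 0 r * g (z - r)) z
      simpa using this
    rw [h1, intervalIntegral.integral_of_le (by linarith [hz.1])]
    refine setIntegral_eq_of_subset_of_forall_sdiff_eq_zero measurableSet_Ioc
      (Ioc_subset_Ioc_right (by linarith [hz.2])) fun r hr => ?_
    have : z - c < r := by
      by_contra h
      exact hr.2 ⟨hr.1.1, not_lt.1 h⟩
    rw [hg _ (by linarith), mul_zero]
  have hw0z : ∀ s ≤ c, w0 s = 0 := fun s hs => by simp [hw0, max_eq_right hs, hWc]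
  have hd0z : ∀ s ≤ c, d0 s = 0 := fun s hs => by simp [hd0, hs.not_gt]
  have hder : HasDerivAt (fun z => ∫ r in Ioc 0 (q - c), K 0 r * w0 (z - r))
      (∫ r in Ioc 0 (q - c), K 0 r * d0 (y - r)) y := by
    -- The Lipschitz version of differentiation under the integral asks for a derivative only at
    -- almost every `r`; the kink sits at the single point `r = y - c`.
    refine (hasDerivAt_integral_of_dominated_loc_of_lip (𝕜 := ℝ)
      (bound := fun r => ‖K 0 r‖ * M) univ_mem ?_ ?_ ?_ ?_
      ((hK.integrableOn_Ioc hq).norm.mul_const M) ?_).2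
    · exact Eventually.of_forall fun z =>
        hKm.mul (hcw0.comp (by fun_prop : Continuous fun r => z - r)).aestronglyMeasurable
    · have := hK0.mul_continuousOn (g := fun r => w0 (y - r))
        (hcw0.comp (by fun_prop : Continuous fun r => y - r)).continuousOn
      exact (intervalIntegrable_iff_integrableOn_Ioc_of_le hL).1 this
    · exact hKm.mul (hd0m.comp (by fun_prop : Measurable fun r => y - r)).aestronglyMeasurable
    · refine Eventually.of_forall fun r => (LipschitzWith.of_dist_le_mul fun s t => ?_).lipschitzOnWith
      have h1 := hLip.dist_le_mul (s - r) (t - r)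
      rw [Real.coe_toNNReal _ hM0, dist_sub_right] at h1
      rw [Real.coe_nnabs, abs_of_nonneg (by positivity), dist_eq_norm, ← mul_sub, norm_mul,
        ← dist_eq_norm, mul_assoc]
      exact mul_le_mul_of_nonneg_left h1 (norm_nonneg _)
    · have hne : ∀ᵐ r ∂(volume.restrict (Ioc 0 (q - c))), r ≠ y - c :=
        ae_restrict_of_ae (by simp [ae_iff])
      filter_upwards [hne] with r hr
      have h := (hw0d (y - r) (fun h => hr (by linarith))).scomp y
        ((hasDerivAt_id y).sub_const r)
      simpa using h.const_mul (K 0 r)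
  have hprim : HasDerivWithinAt (fun z => (∫ r in (0:ℝ)..(z - c), K 0 r) * w c)
      (K 0 (y - c) * w c) (Icc c q) y := by
    have hmem : y - c ∈ Ioo 0 ρ := ⟨by linarith [hy.1], by linarith [hy.2]⟩
    have h1 : HasDerivAt (fun z => ∫ r in (0:ℝ)..z, K 0 r) (K 0 (y - c)) (y - c) :=
      intervalIntegral.integral_hasDerivAt_right (hK.intervalIntegrable hmem.1.le hmem.2)
        ((hK.continuousOn 0).stronglyMeasurableAtFilter isOpen_Ioo _ hmem)
        ((hK.hasDerivAt 0 _ hmem).continuousAt)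
    have h2 := h1.scomp y ((hasDerivAt_id y).sub_const c)
    have h3 := h2.mul_const (w c)
    simp only [one_smul] at h3
    exact h3.hasDerivWithinAt
  have hfin := hprim.add hder.hasDerivWithinAt
  have hyI : y ∈ Icc c q := ⟨hy.1.le, hy.2⟩
  have hval : ∫ r in Ioc 0 (q - c), K 0 r * d0 (y - r) = ∫ s in c..y, K 0 (y - s) * w' s := by
    rw [key y hyI d0 hd0z]
    refine intervalIntegral.integral_congr_ae (Eventually.of_forall fun s hs => ?_)
    rw [uIoc_of_le hy.1.le] at hs
    simp only [hd0, if_pos hs.1, hee s ⟨hs.1.le, hs.2.trans hy.2⟩]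
  rw [hval] at hfin
  refine hfin.congr_of_mem (fun z hz => ?_) hyI
  have hzl : z - c < ρ := by linarith [hz.2]
  simp only [Pi.add_apply]
  rw [key z hz w0 hw0z]
  have h1 : ∫ r in (0:ℝ)..(z - c), K 0 r = ∫ s in c..z, K 0 (z - s) := by
    rw [intervalIntegral.integral_comp_sub_left (fun r => K 0 r) z]; simp
  rw [h1, ← intervalIntegral.integral_mul_const, ← intervalIntegral.integral_add
    ((hK.intervalIntegrable_reflect hz.1 hzl).mul_const _)
    (hK.near_intervalIntegrable hz.1 hzl hcw0.continuousOn)]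
  refine intervalIntegral.integral_congr fun s hs => ?_
  rw [uIcc_of_le hz.1] at hs
  simp only [hw0, max_eq_left hs.1]
  rw [hWw s ⟨hs.1, hs.2.trans hz.2⟩]
  ring

end SmoothKernel

/-- `v 0` is integrable on `[p,q]` and `m` times continuously differentiable on `(p,q]`, with
derivatives `v 1, …, v m`. -/
structure SmoothData (v : ℕ → ℝ → ℂ) (m : ℕ) (p q : ℝ) : Prop where
  hasDerivWithinAt : ∀ k < m, ∀ y ∈ Ioc p q, HasDerivWithinAt (v k) (v (k + 1) y) (Icc p q) y
  continuousOn_top : ContinuousOn (v m) (Ioc p q)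
  integrableOn : IntegrableOn (v 0) (Ioc p q)

namespace SmoothData

variable {v : ℕ → ℝ → ℂ} {m : ℕ} {p q : ℝ}

theorem continuousOn (hv : SmoothData v m p q) {k : ℕ} (hk : k ≤ m) :
    ContinuousOn (v k) (Ioc p q) := by
  rcases hk.eq_or_lt with rfl | h
  · exact hv.continuousOn_top
  · exact fun y hy => ((hv.hasDerivWithinAt k h y hy).continuousWithinAt).mono Ioc_subset_Icc_self

theorem continuousOn_Icc (hv : SmoothData v m p q) {k : ℕ} (hk : k ≤ m) {c y : ℝ} (hc : p < c)
    (hy : y ≤ q) : ContinuousOn (v k) (Icc c y) :=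
  (hv.continuousOn hk).mono fun _ hs => ⟨hc.trans_le hs.1, hs.2.trans hy⟩

theorem intervalIntegrable (hv : SmoothData v m p q) {c : ℝ} (hpc : p ≤ c) (hcq : c ≤ q) :
    IntervalIntegrable (v 0) volume p c :=
  (intervalIntegrable_iff_integrableOn_Ioc_of_le hpc).2
    (hv.integrableOn.mono_set (Ioc_subset_Ioc_right hcq))

end SmoothData

/-- The `k`-th derivative of `y ↦ ∫ s in p..y, K 0 (y - s) * v 0 s` to the right of `c`. -/
def convDeriv (K v : ℕ → ℝ → ℂ) (p c : ℝ) (k : ℕ) (y : ℝ) : ℂ :=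
  (∫ s in p..c, K k (y - s) * v 0 s) +
    ((∑ j ∈ Finset.range k, K (k - 1 - j) (y - c) * v j c) +
      ∫ s in c..y, K 0 (y - s) * v k s)

/-! ### Iterated derivatives of a convolution -/

namespace SmoothKernel

variable {K v : ℕ → ℝ → ℂ} {ρ p q c : ℝ} {m : ℕ}

/-- The far integral and the old boundary terms pass to the next derivative of the kernel. The near
integral releases `K 0 (y - c) * v k c`, which is the new last summand `j = k`. -/
theorem convDeriv_hasDerivWithinAt (hK : SmoothKernel K ρ) (hv : SmoothData v m p q)
    (hρ : q - p < ρ) (hc : p < c) {k : ℕ} (hk : k < m) {y : ℝ} (hy : y ∈ Ioc c q) :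
    HasDerivWithinAt (convDeriv K v p c k) (convDeriv K v p c (k + 1) y) (Icc p q) y := by
  have hcq : c ≤ q := hy.1.le.trans hy.2
  have hsub : Icc c q ⊆ Icc p q := Icc_subset_Icc_left hc.le
  have hn : 𝓝[Icc p q] y = 𝓝[Icc c q] y := by
    refine nhdsWithin_eq_nhdsWithin (mem_Ioi.2 hy.1) isOpen_Ioi ?_
    ext s
    simp only [mem_inter_iff, mem_Icc, mem_Ioi]
    constructor <;> rintro ⟨⟨h1, h2⟩, h3⟩ <;> exact ⟨⟨by linarith, h2⟩, h3⟩
  have h1 := (hK.far_hasDerivAt k hc.le hy.1 (by linarith [hy.2])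
    (hv.intervalIntegrable hc.le hcq)).hasDerivWithinAt (s := Icc c q)
  have h2 := hK.near_hasDerivWithinAt (w := v k) (w' := v (k + 1)) (by linarith)
    (fun s hs => (hv.hasDerivWithinAt k hk s ⟨hc.trans_le hs.1, hs.2⟩).mono hsub)
    (hv.continuousOn_Icc hk hc le_rfl) hy
  have h3 : HasDerivWithinAt (fun y => ∑ j ∈ Finset.range k, K (k - 1 - j) (y - c) * v j c)
      (∑ j ∈ Finset.range k, K (k - j) (y - c) * v j c) (Icc c q) y := by
    refine HasDerivWithinAt.fun_sum fun j hj => ?_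
    have hj' := Finset.mem_range.1 hj
    have h := (hK.hasDerivAt (k - 1 - j) (y - c) ⟨by linarith [hy.1], by linarith [hy.2]⟩).scomp y
      ((hasDerivAt_id y).sub_const c)
    rw [show k - 1 - j + 1 = k - j by omega] at h
    have h' := (h.mul_const (v j c)).hasDerivWithinAt (s := Icc c q)
    simpa using h'
  have h4 := h1.add (h3.add h2)
  have h5 : HasDerivWithinAt (convDeriv K v p c k) (convDeriv K v p c (k + 1) y) (Icc c q) y := by
    refine HasDerivWithinAt.congr_deriv h4 ?_
    simp only [convDeriv, Finset.sum_range_succ, Nat.add_sub_cancel, Nat.sub_self]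
    ring
  unfold HasDerivWithinAt HasDerivAtFilter at h5 ⊢
  rw [hn]
  exact h5

theorem conv_intervalIntegrable (hK : SmoothKernel K ρ) (hv : SmoothData v m p q)
    (hρ : q - p < ρ) {y : ℝ} (hy : y ∈ Ioc p q) :
    IntervalIntegrable (fun s => K 0 (y - s) * v 0 s) volume p y := by
  obtain ⟨c, hc1, hc2⟩ := exists_between hy.1
  exact (hK.far_intervalIntegrable 0 hc1.le hc2 (by linarith [hy.2])
    (hv.intervalIntegrable hc1.le (hc2.le.trans hy.2))).trans
    (hK.near_intervalIntegrable hc2.le (by linarith [hy.2])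
      (hv.continuousOn_Icc (Nat.zero_le _) hc1 hy.2))

theorem convDeriv_zero (hK : SmoothKernel K ρ) (hv : SmoothData v m p q)
    (hρ : q - p < ρ) (hc : p < c) {y : ℝ} (hy : y ∈ Ioc c q) :
    convDeriv K v p c 0 y = ∫ s in p..y, K 0 (y - s) * v 0 s := by
  rw [← intervalIntegral.integral_add_adjacent_intervals
    (hK.far_intervalIntegrable 0 hc.le hy.1 (by linarith [hy.2])
      (hv.intervalIntegrable hc.le (hy.1.le.trans hy.2)))
    (hK.near_intervalIntegrable hy.1.le (by linarith [hy.2])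
      (hv.continuousOn_Icc (Nat.zero_le _) hc hy.2))]
  simp [convDeriv]

/-- If `K 1` is integrable as well and `K 0` vanishes at `0`, the derivative can stay on the kernel:
integrating by parts on `[c,y]`, the boundary term at `y` is zero and the one at `c` cancels the one
in `convDeriv`. -/
theorem convDeriv_one (hK : SmoothKernel K ρ) (hK' : SmoothKernel (fun k => K (k + 1)) ρ)
    (hcont : ContinuousOn (K 0) (Ico 0 ρ)) (hK0 : K 0 0 = 0)
    (hv : SmoothData v m p q) (hm : 0 < m)
    (hρ : q - p < ρ) (hc : p < c) {y : ℝ} (hy : y ∈ Ioc c q) :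
    convDeriv K v p c 1 y = ∫ s in p..y, K 1 (y - s) * v 0 s := by
  have hyρ : y - p < ρ := by linarith [hy.2]
  have hcv := hv.continuousOn_Icc (Nat.zero_le m) hc hy.2
  have i1 := hK'.near_intervalIntegrable hy.1.le (by linarith) hcv
  have i2 := hK.near_intervalIntegrable hy.1.le (by linarith)
    (hv.continuousOn_Icc (Nat.succ_le_of_lt hm) hc hy.2)
  have hparts := intervalIntegral.integral_eq_sub_of_hasDeriv_right_of_le
    (f := fun s => K 0 (y - s) * v 0 s)
    (f' := fun s => K 0 (y - s) * v 1 s - K 1 (y - s) * v 0 s) hy.1.le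
    ((hcont.comp (by fun_prop) fun s hs => ⟨by linarith [hs.2], by linarith [hs.1]⟩).mul hcv)
    (fun s hs => by
      have h1 := (hK.hasDerivAt 0 (y - s) ⟨by linarith [hs.2], by linarith [hs.1]⟩).scomp s
        ((hasDerivAt_id s).const_sub y)
      have h2 := (hv.hasDerivWithinAt 0 hm s ⟨hc.trans hs.1, hs.2.le.trans hy.2⟩).hasDerivAt
        (Icc_mem_nhds (hc.trans hs.1) (hs.2.trans_le hy.2))
      refine ((h1.mul h2).congr_deriv ?_).hasDerivWithinAt
      simp only [Function.comp_apply, neg_smul, one_smul, zero_add]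
      ring) (i2.sub i1)
  rw [intervalIntegral.integral_sub i2 i1, sub_self, hK0, zero_mul, zero_sub] at hparts
  rw [← intervalIntegral.integral_add_adjacent_intervals
    (hK.far_intervalIntegrable 1 hc.le hy.1 (by linarith [hy.2])
      (hv.intervalIntegrable hc.le (hy.1.le.trans hy.2))) i1]
  simp only [convDeriv, Finset.sum_range_one]
  linear_combination hparts

end SmoothKernel

/-- A series of smooth kernels that can be integrated and differentiated term by term. -/
structure KernelSeries (Kn : ℕ → ℕ → ℝ → ℂ) (K : ℕ → ℝ → ℂ) (l ρ : ℝ) : Prop where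
  smooth : ∀ n, SmoothKernel (Kn n) ρ
  smooth_sum : SmoothKernel K ρ
  hasSum : ∀ k, ∀ r ∈ Ioc 0 l, HasSum (fun n => Kn n k r) (K k r)
  bound : ∀ k, ∀ d > 0, ∃ U : ℕ → ℝ, Summable U ∧ ∀ n, ∀ r ∈ Icc d l, ‖Kn n k r‖ ≤ U n
  bound_zero : ∃ (U : ℕ → ℝ) (g : ℝ → ℝ), Summable U ∧ IntegrableOn g (Ioc 0 l) ∧
    ∀ n, ∀ r ∈ Ioc 0 l, ‖Kn n 0 r‖ ≤ U n * g r

/-! ### Termwise differentiation of convolutions with a series of kernels -/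

namespace KernelSeries

variable {Kn : ℕ → ℕ → ℝ → ℂ} {K v : ℕ → ℝ → ℂ} {l ρ p q c : ℝ} {m : ℕ}

theorem near_bound_and_hasSum (h : KernelSeries Kn K (q - p) ρ) (hρ : q - p < ρ)
    (hc : p < c) {w : ℝ → ℂ} (hw : ContinuousOn w (Icc c q)) :
    ∃ U : ℕ → ℝ, Summable U ∧ ∀ y ∈ Ioc c q,
      (∀ n, ‖∫ s in c..y, Kn n 0 (y - s) * w s‖ ≤ U n) ∧
      HasSum (fun n => ∫ s in c..y, Kn n 0 (y - s) * w s) (∫ s in c..y, K 0 (y - s) * w s) := by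
  obtain ⟨U, g, hU, hg, hb⟩ := h.bound_zero
  obtain ⟨M, hM⟩ := isCompact_Icc.exists_bound_of_continuousOn hw
  -- Absolute values are needed because neither `U n` nor `g` is assumed nonnegative.
  refine ⟨fun n => |U n| * ((∫ r in Ioc 0 (q - p), |g r|) * M), (hU.abs).mul_right _, ?_⟩
  intro y hy
  have hM0 : 0 ≤ M := (norm_nonneg _).trans (hM y ⟨hy.1.le, hy.2⟩)
  have hgy : IntervalIntegrable (fun s => |g (y - s)|) volume c y := by
    have h1 : IntervalIntegrable (fun r => |g r|) volume 0 (y - c) :=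
      (intervalIntegrable_iff_integrableOn_Ioc_of_le (by linarith [hy.1])).2
        (IntegrableOn.mono_set hg.abs (Ioc_subset_Ioc_right (by linarith [hy.2])))
    simpa using (h1.comp_sub_left y).symm
  have hbd : ∀ n, ∀ s ∈ Ico c y, ‖Kn n 0 (y - s) * w s‖ ≤ |U n| * (|g (y - s)| * M) := by
    intro n s hs
    rw [norm_mul, ← mul_assoc]
    refine mul_le_mul ((hb n (y - s) ⟨by linarith [hs.2], by linarith [hs.1, hy.2]⟩).trans ?_)
      (hM s ⟨hs.1, hs.2.le.trans hy.2⟩) (norm_nonneg _) (by positivity)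
    rw [← abs_mul]
    exact le_abs_self _
  -- At `s = y` the kernel is evaluated at `0`, where nothing is known about it.
  have hae : ∀ᵐ s : ℝ, s ≠ y := by simp [ae_iff]
  have hmeas : ∀ n, AEStronglyMeasurable (fun s => Kn n 0 (y - s) * w s)
      (volume.restrict (uIoc c y)) := fun n =>
    ((h.smooth n).near_intervalIntegrable hy.1.le (by linarith [hy.2])
      (hw.mono (Icc_subset_Icc_right hy.2))).def'.aestronglyMeasurable
  have hbae : ∀ n, ∀ᵐ s : ℝ, s ∈ uIoc c y →
      ‖Kn n 0 (y - s) * w s‖ ≤ |U n| * (|g (y - s)| * M) := by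
    intro n
    filter_upwards [hae] with s hs hsI
    rw [uIoc_of_le hy.1.le] at hsI
    exact hbd n s ⟨hsI.1.le, lt_of_le_of_ne hsI.2 hs⟩
  refine ⟨fun n => ?_, ?_⟩
  · have h1 := intervalIntegral.norm_integral_le_of_norm_le hy.1.le
      (by filter_upwards [hbae n] with s hs hsI; exact hs (by rwa [uIoc_of_le hy.1.le]))
      ((hgy.mul_const M).const_mul |U n|)
    refine h1.trans ?_
    rw [intervalIntegral.integral_const_mul, intervalIntegral.integral_mul_const,
      intervalIntegral.integral_comp_sub_left (fun r => |g r|), sub_self,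
      intervalIntegral.integral_of_le (by linarith [hy.1])]
    have h2 : ∫ r in Ioc 0 (y - c), |g r| ≤ ∫ r in Ioc 0 (q - p), |g r| :=
      setIntegral_mono_set hg.abs (Eventually.of_forall fun _ => abs_nonneg _)
        (Ioc_subset_Ioc_right (by linarith [hy.2])).eventuallyLE
    exact mul_le_mul_of_nonneg_left (mul_le_mul_of_nonneg_right h2 hM0) (abs_nonneg _)
  · refine intervalIntegral.hasSum_integral_of_dominated_convergence
      (fun n s => |U n| * (|g (y - s)| * M)) hmeas hbae
      (Eventually.of_forall fun s _ => hU.abs.mul_right _) ?_ ?_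
    · simp_rw [tsum_mul_right]
      exact (hgy.mul_const M).const_mul _
    · filter_upwards [hae] with s hs hsI
      rw [uIoc_of_le hy.1.le] at hsI
      exact (h.hasSum 0 (y - s) ⟨by linarith [lt_of_le_of_ne hsI.2 hs],
        by linarith [hsI.1, hy.2]⟩).mul_right _

/-- For `s ≤ c` and `y ≥ c'` one has `y - s ≥ c' - c > 0`, so a single summable bound serves all
these `y`. -/
theorem far_bound_and_hasSum (h : KernelSeries Kn K (q - p) ρ) (hρ : q - p < ρ) (k : ℕ)
    (hc : p < c) {c' : ℝ} (hc' : c < c') {w : ℝ → ℂ} (hw : IntervalIntegrable w volume p c) :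
    ∃ U : ℕ → ℝ, Summable U ∧ ∀ y ∈ Icc c' q,
      (∀ n, ‖∫ s in p..c, Kn n k (y - s) * w s‖ ≤ U n) ∧
      HasSum (fun n => ∫ s in p..c, Kn n k (y - s) * w s) (∫ s in p..c, K k (y - s) * w s) := by
  obtain ⟨U, hU, hb⟩ := h.bound k (c' - c) (sub_pos.2 hc')
  refine ⟨fun n => U n * ∫ s in p..c, ‖w s‖, hU.mul_right _, fun y hy => ?_⟩
  have hcy : c < y := hc'.trans_le hy.1
  have hbd : ∀ n, ∀ s ∈ Ioc p c, ‖Kn n k (y - s) * w s‖ ≤ U n * ‖w s‖ := by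
    intro n s hs
    rw [norm_mul]
    exact mul_le_mul_of_nonneg_right (hb n _ ⟨by linarith [hs.2, hy.1], by linarith [hs.1, hy.2]⟩)
      (norm_nonneg _)
  refine ⟨fun n => ?_, ?_⟩
  · have h1 := intervalIntegral.norm_integral_le_of_norm_le hc.le
      (Eventually.of_forall fun s hs => hbd n s hs) (hw.norm.const_mul (U n))
    rwa [intervalIntegral.integral_const_mul] at h1
  · refine intervalIntegral.hasSum_integral_of_dominated_convergence
      (fun n s => U n * ‖w s‖)
      (fun n => ((h.smooth n).far_intervalIntegrable k hc.le hcy (by linarith [hy.2])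
        hw).def'.aestronglyMeasurable)
      (fun n => Eventually.of_forall fun s hs => hbd n s (by rwa [uIoc_of_le hc.le] at hs))
      (Eventually.of_forall fun s _ => hU.mul_right _) ?_ (Eventually.of_forall fun s hs => ?_)
    · simp_rw [tsum_mul_right]
      exact hw.norm.const_mul _
    · rw [uIoc_of_le hc.le] at hs
      exact (h.hasSum k (y - s) ⟨by linarith [hs.2], by linarith [hs.1, hy.2]⟩).mul_right _

/-- Weierstrass test applied to the three parts of `convDeriv`. The gap between `c` and `c'` keeps
the arguments `y - c` of the boundary terms away from `0`. -/
theorem convDeriv_hasSumUniformlyOn (h : KernelSeries Kn K (q - p) ρ) (hρ : q - p < ρ)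
    (hv : SmoothData v m p q) (hc : p < c) {c' : ℝ} (hc' : c < c') (hcq : c' ≤ q) :
    HasSumUniformlyOn (fun n => convDeriv (Kn n) v p c m) (convDeriv K v p c m) (Icc c' q) := by
  obtain ⟨U₁, hU₁, h₁⟩ := h.far_bound_and_hasSum hρ m hc hc'
    (hv.intervalIntegrable hc.le (hc'.le.trans hcq))
  obtain ⟨U₂, hU₂, h₂⟩ := h.near_bound_and_hasSum hρ hc (hv.continuousOn_Icc le_rfl hc le_rfl)
  choose U₃ hU₃ h₃ using fun k => h.bound k (c' - c) (sub_pos.2 hc')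
  have hsum : Summable fun n => U₁ n +
      ((∑ j ∈ Finset.range m, U₃ (m - 1 - j) n * ‖v j c‖) + U₂ n) :=
    hU₁.add ((summable_sum fun j _ => (hU₃ _).mul_right _).add hU₂)
  have hmem : ∀ y ∈ Icc c' q, y ∈ Ioc c q := fun y hy => ⟨hc'.trans_le hy.1, hy.2⟩
  rw [hasSumUniformlyOn_iff_tendstoUniformlyOn]
  refine (tendstoUniformlyOn_tsum hsum (f := fun n => convDeriv (Kn n) v p c m)
    (s := Icc c' q) fun n y hy => ?_).congr_right fun y hy => ?_
  · refine (norm_add_le _ _).trans (add_le_add ((h₁ y hy).1 n) ((norm_add_le _ _).trans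
      (add_le_add ((norm_sum_le _ _).trans (Finset.sum_le_sum fun j _ => ?_))
        ((h₂ y (hmem y hy)).1 n))))
    rw [norm_mul]
    exact mul_le_mul_of_nonneg_right
      (h₃ _ n _ ⟨by linarith [hy.1], by linarith [hy.2]⟩) (norm_nonneg _)
  · refine HasSum.tsum_eq ((h₁ y hy).2.add (HasSum.add (hasSum_sum fun j _ => ?_)
      (h₂ y (hmem y hy)).2))
    exact (h.hasSum _ _ ⟨by linarith [hy.1], by linarith [hy.2]⟩).mul_right _

end KernelSeries

/-! ### Power kernels and their series -/

/-- The `k`-th derivative of `r ↦ r ^ (γ - 1)`. -/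
def powKernel (γ : ℂ) (k : ℕ) (r : ℝ) : ℂ :=
  (∏ i ∈ Finset.range k, (γ - 1 - i)) * (r : ℂ) ^ (γ - 1 - k)

@[simp]
theorem powKernel_zero (γ : ℂ) (r : ℝ) : powKernel γ 0 r = (r : ℂ) ^ (γ - 1) := by
  simp [powKernel]

theorem powKernel_succ (γ : ℂ) (k : ℕ) (r : ℝ) :
    powKernel (γ + 1) (k + 1) r = γ * powKernel γ k r := by
  simp only [powKernel, Finset.prod_range_succ']
  push_cast
  rw [show γ + 1 - 1 - ((k : ℂ) + 1) = γ - 1 - k by ring]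
  have h : ∏ i ∈ Finset.range k, (γ + 1 - 1 - ((i : ℂ) + 1)) = ∏ i ∈ Finset.range k, (γ - 1 - i) :=
    Finset.prod_congr rfl fun i _ => by ring
  rw [h]
  ring

theorem powKernel_hasDerivAt (γ : ℂ) (k : ℕ) {r : ℝ} (hr : 0 < r) :
    HasDerivAt (powKernel γ k) (powKernel γ (k + 1) r) r := by
  have h := (((hasDerivAt_id (r : ℂ)).cpow_const (c := γ - 1 - k)
    (Complex.ofReal_mem_slitPlane.2 hr)).comp_ofReal).const_mul
      (∏ i ∈ Finset.range k, (γ - 1 - (i : ℂ)))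
  refine h.congr_deriv ?_
  simp only [powKernel, Finset.prod_range_succ, id]
  push_cast
  rw [show γ - 1 - ((k : ℂ) + 1) = γ - 1 - k - 1 by ring]
  ring

theorem smoothKernel_powKernel {γ : ℂ} (hγ : 0 < γ.re) (ρ : ℝ) :
    SmoothKernel (powKernel γ) ρ where
  hasDerivAt k r hr := powKernel_hasDerivAt γ k hr.1
  integrableOn := by
    rcases le_or_gt ρ 0 with h | h
    · simp [Ioo_eq_empty h.not_gt]
    · have h1 := intervalIntegral.intervalIntegrable_cpow' (a := 0) (b := ρ) (r := γ - 1)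
        (by simp; linarith)
      exact ((((intervalIntegrable_iff_integrableOn_Ioc_of_le h.le).1 h1).mono_set
        Ioo_subset_Ioc_self).congr_fun (fun r _ => (powKernel_zero γ r).symm) measurableSet_Ioo)

theorem SmoothKernel.const_mul {K : ℕ → ℝ → ℂ} {ρ : ℝ} (hK : SmoothKernel K ρ) (z : ℂ) :
    SmoothKernel (fun k r => z * K k r) ρ where
  hasDerivAt k r hr := (hK.hasDerivAt k r hr).const_mul z
  integrableOn := hK.integrableOn.const_mul z

theorem smoothKernel_powKernel_succ {γ : ℂ} (hγ : 0 < γ.re) (ρ : ℝ) :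
    SmoothKernel (fun k => powKernel (γ + 1) (k + 1)) ρ := by
  have h : (fun k => powKernel (γ + 1) (k + 1)) = fun k r => γ * powKernel γ k r := by
    funext k r; exact powKernel_succ γ k r
  rw [h]
  exact (smoothKernel_powKernel hγ ρ).const_mul γ

theorem powKernel_succ_continuous {γ : ℂ} (hγ : 0 < γ.re) : Continuous (powKernel (γ + 1) 0) := by
  have h : powKernel (γ + 1) 0 = fun r : ℝ => (r : ℂ) ^ γ := by funext r; simp
  rw [h]
  exact Complex.continuous_ofReal_cpow_const hγ

theorem powKernel_succ_zero {γ : ℂ} (hγ : 0 < γ.re) : powKernel (γ + 1) 0 0 = 0 := by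
  have h : γ ≠ 0 := by rintro rfl; simp at hγ
  simp [h]

/-- Each of the `k` factors grows at most linearly in `n`. -/
theorem norm_powKernel_coeff_le (γ β : ℂ) (k : ℕ) :
    ∃ D : ℝ, 0 ≤ D ∧ ∀ n : ℕ,
      ‖∏ i ∈ Finset.range k, (γ + β * n - 1 - i)‖ ≤ D * ((n : ℝ) + 1) ^ k := by
  induction k with
  | zero => exact ⟨1, zero_le_one, fun n => by simp⟩
  | succ k ih =>
    obtain ⟨D, hD0, hD⟩ := ih
    refine ⟨D * (‖γ‖ + ‖β‖ + 1 + k), by positivity, fun n => ?_⟩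
    rw [Finset.prod_range_succ, norm_mul, pow_succ]
    have h1 : ‖γ + β * n - 1 - k‖ ≤ (‖γ‖ + ‖β‖ + 1 + k) * ((n : ℝ) + 1) := by
      have h2 : ‖γ + β * n - 1 - k‖ ≤ ‖γ‖ + ‖β‖ * n + 1 + k := by
        refine (norm_sub_le _ _).trans ?_
        refine add_le_add ((norm_sub_le _ _).trans ?_) (by simp)
        refine add_le_add ((norm_add_le _ _).trans ?_) (by simp)
        rw [norm_mul, Complex.norm_natCast]
      have : 0 ≤ (‖γ‖ + 1 + k) * (n : ℝ) + ‖β‖ := by positivity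
      linarith
    calc _ ≤ (D * ((n : ℝ) + 1) ^ k) * ((‖γ‖ + ‖β‖ + 1 + k) * ((n : ℝ) + 1)) :=
          mul_le_mul (hD n) h1 (norm_nonneg _) (by positivity)
      _ = _ := by ring

theorem ConvergesOnDisc.summable_norm_mul_pow {B : PowerSeries ℂ} {R : ℝ}
    (hB : ConvergesOnDisc B R) {x : ℝ} (hx0 : 0 ≤ x) (hx : x < R) (k : ℕ) :
    Summable fun n : ℕ => ‖PowerSeries.coeff n B‖ * ((n : ℝ) + 1) ^ k * x ^ n := by
  obtain ⟨y, hxy, hyR⟩ := exists_between hx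
  have hy0 : 0 < y := hx0.trans_lt hxy
  have hs := hB (y : ℂ) (by simpa [abs_of_pos hy0] using hyR)
  obtain ⟨M, hM⟩ := hs.tendsto_atTop_zero.norm.bddAbove_range
  -- With `x / y < t < 1` the terms are at most `M (n+1)^k t^n`: the coefficients times `y^n` are
  -- bounded, and the geometric decay of `t^n` beats the polynomial.
  obtain ⟨t, ht1, ht2⟩ := exists_between ((div_lt_one hy0).2 hxy)
  have ht0 : 0 < t := (div_nonneg hx0 hy0.le).trans_lt ht1
  have hg : Summable fun n : ℕ => ((n : ℝ) + 1) ^ k * t ^ n := by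
    have h1 := (summable_nat_add_iff 1).2 (summable_pow_mul_geometric_of_norm_lt_one k
      (r := t) (by rwa [Real.norm_of_nonneg ht0.le]))
    refine (h1.mul_right t⁻¹).congr fun n => ?_
    push_cast
    field_simp
    ring
  refine Summable.of_nonneg_of_le (fun n => by positivity) (fun n => ?_) (hg.mul_left M)
  have h2 : ‖PowerSeries.coeff n B‖ * y ^ n ≤ M := by
    have := hM ⟨n, rfl⟩
    simpa [abs_of_pos hy0] using this
  have h3 : x ^ n ≤ y ^ n * t ^ n := by
    rw [← mul_pow]
    exact pow_le_pow_left₀ hx0 (by rw [div_lt_iff₀ hy0] at ht1; linarith) n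
  calc _ ≤ ‖PowerSeries.coeff n B‖ * ((n : ℝ) + 1) ^ k * (y ^ n * t ^ n) := by gcongr
    _ = (‖PowerSeries.coeff n B‖ * y ^ n) * (((n : ℝ) + 1) ^ k * t ^ n) := by ring
    _ ≤ _ := by gcongr

/-- The `k`-th derivative of the `n`-th term of `r ↦ r ^ (γ - 1) * B (r ^ β)`. -/
def seriesTerm (B : PowerSeries ℂ) (γ β : ℂ) (n k : ℕ) (r : ℝ) : ℂ :=
  PowerSeries.coeff n B * powKernel (γ + β * n) k r

/-- The `k`-th derivative of `r ↦ r ^ (γ - 1) * B (r ^ β)`. -/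
def seriesKernel (B : PowerSeries ℂ) (γ β : ℂ) (k : ℕ) (r : ℝ) : ℂ :=
  ∑' n : ℕ, seriesTerm B γ β n k r

theorem seriesKernel_zero (B : PowerSeries ℂ) (γ β : ℂ) {r : ℝ} (hr : 0 < r) :
    seriesKernel B γ β 0 r = (r : ℂ) ^ (γ - 1) * kernelEval B ((r : ℂ) ^ β) := by
  have hr' : (r : ℂ) ≠ 0 := Complex.ofReal_ne_zero.2 hr.ne'
  simp only [seriesKernel, seriesTerm, kernelEval, powKernel_zero, ← tsum_mul_left]
  refine tsum_congr fun n => ?_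
  rw [show γ + β * n - 1 = (γ - 1) + β * n by ring, Complex.cpow_add _ _ hr',
    Complex.cpow_mul_nat]
  ring

theorem re_add_mul_natCast_pos {γ β : ℂ} (hγ : 0 < γ.re) (hβ : 0 < β.re) (n : ℕ) :
    0 < (γ + β * n).re := by
  have : 0 ≤ β.re * n := by positivity
  simp
  linarith

/-- Since `|r^(βn)| = (r^(Re β))^n ≤ (ρ^(Re β))^n`, the dependence on `n` separates from the power
of `r`, the only singular factor. For `k = 0` that factor is integrable at `0` when `0 < γ.re`. -/
theorem norm_seriesTerm_le {B : PowerSeries ℂ} {R : ℝ} (hB : ConvergesOnDisc B R) (γ : ℂ) {β : ℂ}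
    (hβ : 0 < β.re) {ρ : ℝ} (hρ0 : 0 ≤ ρ) (hρ : ρ ^ β.re < R) (k : ℕ) :
    ∃ U : ℕ → ℝ, Summable U ∧ ∀ n, ∀ r ∈ Ioc 0 ρ,
      ‖seriesTerm B γ β n k r‖ ≤ U n * r ^ (γ.re - 1 - k) := by
  obtain ⟨D, hD0, hD⟩ := norm_powKernel_coeff_le γ β k
  refine ⟨_, (hB.summable_norm_mul_pow (Real.rpow_nonneg hρ0 _) hρ k).mul_left D,
    fun n r hr => ?_⟩
  have h1 : ‖(r : ℂ) ^ (γ + β * n - 1 - k)‖ ≤ (ρ ^ β.re) ^ n * r ^ (γ.re - 1 - k) := by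
    rw [Complex.norm_cpow_eq_rpow_re_of_pos hr.1]
    have h2 : (γ + β * n - 1 - k).re = β.re * n + (γ.re - 1 - k) := by
      simp; ring
    rw [h2, Real.rpow_add hr.1, Real.rpow_mul_natCast hr.1.le]
    have h3 : r ^ β.re ≤ ρ ^ β.re := Real.rpow_le_rpow hr.1.le hr.2 hβ.le
    have := Real.rpow_nonneg hr.1.le β.re
    have := Real.rpow_nonneg hr.1.le (γ.re - 1 - k)
    gcongr
  rw [seriesTerm, powKernel, norm_mul, norm_mul]
  calc _ ≤ ‖PowerSeries.coeff n B‖ * ((D * ((n : ℝ) + 1) ^ k) *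
        ((ρ ^ β.re) ^ n * r ^ (γ.re - 1 - k))) := by
        refine mul_le_mul_of_nonneg_left (mul_le_mul (hD n) h1 (norm_nonneg _) ?_) (norm_nonneg _)
        positivity
    _ = _ := by ring

theorem norm_seriesTerm_le_of_Icc {B : PowerSeries ℂ} {R : ℝ} (hB : ConvergesOnDisc B R) (γ : ℂ)
    {β : ℂ} (hβ : 0 < β.re) {ρ : ℝ} (hρ0 : 0 ≤ ρ) (hρ : ρ ^ β.re < R) (k : ℕ) {d : ℝ} (hd : 0 < d) :
    ∃ U : ℕ → ℝ, Summable U ∧ ∀ n, ∀ r ∈ Icc d ρ, ‖seriesTerm B γ β n k r‖ ≤ U n := by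
  obtain ⟨U, hU, h⟩ := norm_seriesTerm_le hB γ hβ hρ0 hρ k
  obtain ⟨M, hM⟩ := (isCompact_Icc (a := d) (b := ρ)).exists_bound_of_continuousOn
    (f := fun r : ℝ => r ^ (γ.re - 1 - k)) fun r hr =>
      (Real.continuousAt_rpow_const _ _ (Or.inl (hd.trans_le hr.1).ne')).continuousWithinAt
  refine ⟨fun n => |U n| * M, hU.abs.mul_right _, fun n r hr => ?_⟩
  have hr0 := hd.trans_le hr.1
  refine (h n r ⟨hr0, hr.2⟩).trans (mul_le_mul (le_abs_self _) ?_ (by positivity) (abs_nonneg _))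
  exact (le_abs_self _).trans (hM r hr)

theorem exists_kernelSeries {B : PowerSeries ℂ} {R : ℝ} (hB : ConvergesOnDisc B R) {γ β : ℂ}
    (hγ : 0 < γ.re) (hβ : 0 < β.re) {l : ℝ} (hl : 0 < l) (hlR : l ^ β.re < R) :
    ∃ ρ, l < ρ ∧ KernelSeries (seriesTerm B γ β) (seriesKernel B γ β) l ρ := by
  -- The strict inequality leaves room beyond `l`, so the kernels have two-sided derivatives at `r =
  -- l` too.
  obtain ⟨ρ, hlρ, hρR⟩ : ∃ ρ, l < ρ ∧ ρ ^ β.re < R := by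
    have h1 : ∀ᶠ x in 𝓝[>] l, x ^ β.re < R := nhdsWithin_le_nhds
      ((Real.continuousAt_rpow_const l β.re (Or.inl hl.ne')).eventually_lt_const hlR)
    obtain ⟨x, hx, hx'⟩ := (h1.and self_mem_nhdsWithin).exists
    exact ⟨x, hx', hx⟩
  have hρ0 : 0 < ρ := hl.trans hlρ
  have hsm : ∀ n, SmoothKernel (seriesTerm B γ β n) ρ := fun n =>
    (smoothKernel_powKernel (re_add_mul_natCast_pos hγ hβ n) ρ).const_mul _
  have hsum : ∀ k, ∀ r ∈ Ioc 0 ρ, Summable fun n => seriesTerm B γ β n k r := by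
    intro k r hr
    obtain ⟨U, hU, h⟩ := norm_seriesTerm_le hB γ hβ hρ0.le hρR k
    exact Summable.of_norm_bounded (hU.mul_right _) fun n => h n r hr
  have hder : ∀ k, ∀ r ∈ Ioo 0 ρ, HasDerivAt (seriesKernel B γ β k)
      (seriesKernel B γ β (k + 1) r) r := by
    intro k r hr
    obtain ⟨U, hU, h⟩ := norm_seriesTerm_le_of_Icc hB γ hβ hρ0.le hρR (k + 1) (half_pos hr.1)
    have hmem : r ∈ Ioo (r / 2) ρ := ⟨half_lt_self hr.1, hr.2⟩
    exact hasDerivAt_tsum_of_isPreconnected hU isOpen_Ioo isPreconnected_Ioo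
      (fun n s hs => (hsm n).hasDerivAt k s ⟨(half_pos hr.1).trans hs.1, hs.2⟩)
      (fun n s hs => h n s ⟨hs.1.le, hs.2.le⟩) hmem (hsum k r ⟨hr.1, hr.2.le⟩) hmem
  obtain ⟨U, hU, hb⟩ := norm_seriesTerm_le hB γ hβ hρ0.le hρR 0
  have hg : IntegrableOn (fun r : ℝ => r ^ (γ.re - 1 - (0 : ℕ))) (Ioc 0 ρ) :=
    (intervalIntegrable_iff_integrableOn_Ioc_of_le hρ0.le).1
      (intervalIntegral.intervalIntegrable_rpow' (by simp; linarith))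
  refine ⟨ρ, hlρ, hsm, ⟨hder, ?_⟩, fun k r hr => (hsum k r ⟨hr.1, hr.2.trans hlρ.le⟩).hasSum,
    fun k d hd => ?_, U, _, hU, hg.mono_set (Ioc_subset_Ioc_right hlρ.le),
    fun n r hr => hb n r ⟨hr.1, hr.2.trans hlρ.le⟩⟩
  · refine Integrable.mono' ((hg.mono_set Ioo_subset_Ioc_self).const_mul (∑' n, U n))
      (ContinuousOn.aestronglyMeasurable (fun r hr => (hder 0 r hr).continuousAt.continuousWithinAt)
        measurableSet_Ioo) ?_
    refine (ae_restrict_iff' measurableSet_Ioo).2 (Eventually.of_forall fun r hr => ?_)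
    rw [← tsum_mul_right]
    exact tsum_of_norm_bounded (hU.mul_right _).hasSum fun n => hb n r ⟨hr.1, hr.2.le⟩
  · obtain ⟨V, hV, h⟩ := norm_seriesTerm_le_of_Icc hB γ hβ hρ0.le hρR k hd
    exact ⟨V, hV, fun n r hr => h n r ⟨hr.1, hr.2.trans hlρ.le⟩⟩

/-! ### The change of variables `y = φ x` -/

/-- `φ` is a change of variables on `[a,b]`. -/
structure IsChangeOfVariables (a b : ℝ) (φ : ℝ → ℝ) : Prop where
  lt : a < b
  contDiffOn : ContDiffOn ℝ 1 φ (Icc a b)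
  deriv_pos : ∀ x ∈ Icc a b, 0 < derivWithin φ (Icc a b) x

/-- The inverse function of `φ` on `[a,b]`. -/
def phiInv (a b : ℝ) (φ : ℝ → ℝ) : ℝ → ℝ := Function.invFunOn φ (Icc a b)

theorem nhdsWithin_Icc_eq_of_lt {a b c x : ℝ} (hac : a ≤ c) (hx : c < x) :
    𝓝[Icc a b] x = 𝓝[Ioc c b] x := by
  refine nhdsWithin_eq_nhdsWithin (mem_Ioi.2 hx) isOpen_Ioi ?_
  ext s
  simp only [mem_inter_iff, mem_Icc, mem_Ioc, mem_Ioi]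
  constructor
  · rintro ⟨⟨_, h2⟩, h3⟩; exact ⟨⟨h3, h2⟩, h3⟩
  · rintro ⟨⟨_, h2⟩, h3⟩; exact ⟨⟨hac.trans h3.le, h2⟩, h3⟩

theorem phiDeriv_congr {a b c : ℝ} {φ : ℝ → ℝ} {f g : ℝ → ℂ} (hac : a ≤ c)
    (h : EqOn f g (Ioc c b)) : EqOn (phiDeriv a b φ f) (phiDeriv a b φ g) (Ioc c b) := by
  intro x hx
  have h1 : f =ᶠ[𝓝[Icc a b] x] g := by
    rw [nhdsWithin_Icc_eq_of_lt hac hx.1]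
    exact h.eventuallyEq_nhdsWithin
  simp only [phiDeriv, h1.derivWithin_eq (h hx)]

theorem phiDeriv_iterate_congr {a b c : ℝ} {φ : ℝ → ℝ} {f g : ℝ → ℂ} (hac : a ≤ c)
    (h : EqOn f g (Ioc c b)) (k : ℕ) :
    EqOn ((phiDeriv a b φ)^[k] f) ((phiDeriv a b φ)^[k] g) (Ioc c b) := by
  induction k with
  | zero => exact h
  | succ k ih =>
    simp only [Function.iterate_succ_apply']
    exact phiDeriv_congr hac ih

namespace IsChangeOfVariables

variable {a b c : ℝ} {φ : ℝ → ℝ}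

theorem hasDerivWithinAt (h : IsChangeOfVariables a b φ) {x : ℝ} (hx : x ∈ Icc a b) :
    HasDerivWithinAt φ (derivWithin φ (Icc a b) x) (Icc a b) x :=
  (h.contDiffOn.differentiableOn one_ne_zero x hx).hasDerivWithinAt

theorem continuousOn (h : IsChangeOfVariables a b φ) : ContinuousOn φ (Icc a b) :=
  h.contDiffOn.continuousOn

theorem continuousOn_deriv (h : IsChangeOfVariables a b φ) :
    ContinuousOn (derivWithin φ (Icc a b)) (Icc a b) :=
  h.contDiffOn.continuousOn_derivWithin (uniqueDiffOn_Icc h.lt) le_rfl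

theorem strictMonoOn (h : IsChangeOfVariables a b φ) : StrictMonoOn φ (Icc a b) := by
  refine strictMonoOn_of_deriv_pos (convex_Icc a b) h.continuousOn fun x hx => ?_
  rw [interior_Icc] at hx
  rw [← derivWithin_of_mem_nhds (Icc_mem_nhds hx.1 hx.2)]
  exact h.deriv_pos x (Ioo_subset_Icc_self hx)

theorem mapsTo (h : IsChangeOfVariables a b φ) (hc : c ∈ Icc a b) :
    MapsTo φ (Ioc c b) (Ioc (φ c) (φ b)) := fun x hx =>
  have hx' : x ∈ Icc a b := ⟨hc.1.trans hx.1.le, hx.2⟩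
  ⟨h.strictMonoOn hc hx' hx.1, (h.strictMonoOn.le_iff_le hx' (right_mem_Icc.2 h.lt.le)).2 hx.2⟩

theorem image_Ioc (h : IsChangeOfVariables a b φ) {x : ℝ} (hx : x ∈ Icc a b) :
    φ '' Ioc a x = Ioc (φ a) (φ x) := by
  have ha := left_mem_Icc.2 h.lt.le
  refine Subset.antisymm ?_
    (intermediate_value_Ioc hx.1 (h.continuousOn.mono (Icc_subset_Icc_right hx.2)))
  rintro _ ⟨t, ht, rfl⟩
  have ht' : t ∈ Icc a b := ⟨ht.1.le, ht.2.trans hx.2⟩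
  exact ⟨h.strictMonoOn ha ht' ht.1, (h.strictMonoOn.le_iff_le ht' hx).2 ht.2⟩

theorem surjOn (h : IsChangeOfVariables a b φ) : SurjOn φ (Icc a b) (Icc (φ a) (φ b)) :=
  intermediate_value_Icc h.lt.le h.continuousOn

theorem phiInv_mem (h : IsChangeOfVariables a b φ) {y : ℝ} (hy : y ∈ Icc (φ a) (φ b)) :
    phiInv a b φ y ∈ Icc a b := Function.invFunOn_mem (h.surjOn hy)

theorem apply_phiInv (h : IsChangeOfVariables a b φ) {y : ℝ} (hy : y ∈ Icc (φ a) (φ b)) :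
    φ (phiInv a b φ y) = y := Function.invFunOn_eq (h.surjOn hy)

theorem phiInv_apply (h : IsChangeOfVariables a b φ) {x : ℝ} (hx : x ∈ Icc a b) :
    phiInv a b φ (φ x) = x := h.strictMonoOn.injOn.leftInvOn_invFunOn hx

theorem phiInv_mem_Ioc (h : IsChangeOfVariables a b φ) {y : ℝ} (hy : y ∈ Ioc (φ a) (φ b)) :
    phiInv a b φ y ∈ Ioc a b := by
  have hy' := Ioc_subset_Icc_self hy
  refine ⟨lt_of_le_of_ne (h.phiInv_mem hy').1 fun he => ?_, (h.phiInv_mem hy').2⟩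
  have := h.apply_phiInv hy'
  rw [← he] at this
  exact hy.1.ne this

theorem continuousOn_phiInv (h : IsChangeOfVariables a b φ) :
    ContinuousOn (phiInv a b φ) (Icc (φ a) (φ b)) := by
  intro y hy
  refine tendsto_order.2 ⟨fun l hl => ?_, fun u hu => ?_⟩
  · rcases lt_or_ge l a with hla | hla
    · filter_upwards [self_mem_nhdsWithin] with z hz using hla.trans_le (h.phiInv_mem hz).1
    · have hlm : l ∈ Icc a b := ⟨hla, hl.le.trans (h.phiInv_mem hy).2⟩
      have hly : φ l < y := by
        rw [← h.apply_phiInv hy]; exact h.strictMonoOn hlm (h.phiInv_mem hy) hl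
      filter_upwards [self_mem_nhdsWithin, mem_nhdsWithin_of_mem_nhds (Ioi_mem_nhds hly)]
        with z hz hz'
      rw [mem_Ioi, ← h.apply_phiInv hz] at hz'
      exact (h.strictMonoOn.lt_iff_lt hlm (h.phiInv_mem hz)).1 hz'
  · rcases lt_or_ge b u with hub | hub
    · filter_upwards [self_mem_nhdsWithin] with z hz using (h.phiInv_mem hz).2.trans_lt hub
    · have hum : u ∈ Icc a b := ⟨(h.phiInv_mem hy).1.trans hu.le, hub⟩
      have huy : y < φ u := by
        rw [← h.apply_phiInv hy]; exact h.strictMonoOn (h.phiInv_mem hy) hum hu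
      filter_upwards [self_mem_nhdsWithin, mem_nhdsWithin_of_mem_nhds (Iio_mem_nhds huy)]
        with z hz hz'
      rw [mem_Iio, ← h.apply_phiInv hz] at hz'
      exact (h.strictMonoOn.lt_iff_lt (h.phiInv_mem hz) hum).1 hz'

theorem phiInv_hasDerivWithinAt (h : IsChangeOfVariables a b φ) {y : ℝ}
    (hy : y ∈ Icc (φ a) (φ b)) :
    HasDerivWithinAt (phiInv a b φ) (derivWithin φ (Icc a b) (phiInv a b φ y))⁻¹
      (Icc (φ a) (φ b)) y := by
  have hne := (h.deriv_pos _ (h.phiInv_mem hy)).ne'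
  have h1 : HasFDerivWithinAt φ
      (ContinuousLinearEquiv.unitsEquivAut ℝ (Units.mk0 _ hne) : ℝ →L[ℝ] ℝ) (Icc a b)
      (phiInv a b φ y) := by
    have := (h.hasDerivWithinAt (h.phiInv_mem hy)).hasFDerivWithinAt
    have he : (ContinuousLinearEquiv.unitsEquivAut ℝ (Units.mk0 _ hne) : ℝ →L[ℝ] ℝ) =
        ContinuousLinearMap.toSpanSingleton ℝ (derivWithin φ (Icc a b) (phiInv a b φ y)) := by
      ext; simp
    rwa [he]
  have h2 := HasFDerivWithinAt.of_local_left_inverse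
    ((h.continuousOn_phiInv y hy).tendsto_nhdsWithin fun z hz => h.phiInv_mem hz) h1 hy
    (by filter_upwards [self_mem_nhdsWithin] with z hz using h.apply_phiInv hz)
  have h3 := h2.hasDerivWithinAt
  simpa using h3

theorem intervalIntegrable_iff (h : IsChangeOfVariables a b φ) {x : ℝ} (hx : x ∈ Icc a b)
    (g : ℝ → ℂ) :
    IntervalIntegrable (fun t => ((derivWithin φ (Icc a b) t : ℝ) : ℂ) * g (φ t)) volume a x ↔
      IntervalIntegrable g volume (φ a) (φ x) := by
  have hle : φ a ≤ φ x := (h.strictMonoOn.le_iff_le (left_mem_Icc.2 h.lt.le) hx).2 hx.1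
  have hsub : Ioc a x ⊆ Icc a b := fun t ht => ⟨ht.1.le, ht.2.trans hx.2⟩
  rw [intervalIntegrable_iff_integrableOn_Ioc_of_le hx.1,
    intervalIntegrable_iff_integrableOn_Ioc_of_le hle, ← h.image_Ioc hx,
    integrableOn_image_iff_integrableOn_abs_deriv_smul measurableSet_Ioc
      (fun t ht => (h.hasDerivWithinAt (hsub ht)).mono hsub) (h.strictMonoOn.injOn.mono hsub)]
  refine integrableOn_congr_fun (fun t ht => ?_) measurableSet_Ioc
  simp [abs_of_pos (h.deriv_pos t (hsub ht))]

theorem integral_comp (h : IsChangeOfVariables a b φ) {x : ℝ} (hx : x ∈ Icc a b)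
    (g : ℝ → ℂ) :
    ∫ t in a..x, ((derivWithin φ (Icc a b) t : ℝ) : ℂ) * g (φ t) = ∫ y in φ a..φ x, g y := by
  have hle : φ a ≤ φ x := (h.strictMonoOn.le_iff_le (left_mem_Icc.2 h.lt.le) hx).2 hx.1
  have hsub : Ioc a x ⊆ Icc a b := fun t ht => ⟨ht.1.le, ht.2.trans hx.2⟩
  rw [intervalIntegral.integral_of_le hx.1, intervalIntegral.integral_of_le hle,
    ← h.image_Ioc hx, integral_image_eq_integral_abs_deriv_smul measurableSet_Ioc
      (fun t ht => (h.hasDerivWithinAt (hsub ht)).mono hsub) (h.strictMonoOn.injOn.mono hsub)]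
  refine setIntegral_congr_fun measurableSet_Ioc (fun t ht => ?_)
  simp [abs_of_pos (h.deriv_pos t (hsub ht))]

theorem hasDerivWithinAt_comp (h : IsChangeOfVariables a b φ) {F : ℝ → ℂ} {F' : ℂ} {x : ℝ}
    (hx : x ∈ Icc a b) (hF : HasDerivWithinAt F F' (Icc (φ a) (φ b)) (φ x)) :
    HasDerivWithinAt (F ∘ φ) (((derivWithin φ (Icc a b) x : ℝ) : ℂ) * F') (Icc a b) x := by
  have h1 := hF.scomp x (h.hasDerivWithinAt hx) fun t ht =>
    ⟨(h.strictMonoOn.le_iff_le (left_mem_Icc.2 h.lt.le) ht).2 ht.1,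
      (h.strictMonoOn.le_iff_le ht (right_mem_Icc.2 h.lt.le)).2 ht.2⟩
  simpa using h1

/-- Iterated derivatives with respect to `φ` in the variable `y = φ x`. -/
theorem phiDeriv_iterate_eqOn (h : IsChangeOfVariables a b φ) (hc : c ∈ Ico a b) {m : ℕ}
    {F : ℕ → ℝ → ℂ} {f : ℝ → ℂ}
    (hF : ∀ k < m, ∀ y ∈ Ioc (φ c) (φ b),
      HasDerivWithinAt (F k) (F (k + 1) y) (Icc (φ a) (φ b)) y)
    (hf : EqOn f (F 0 ∘ φ) (Ioc c b)) {k : ℕ} (hk : k ≤ m) :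
    EqOn ((phiDeriv a b φ)^[k] f) (F k ∘ φ) (Ioc c b) := by
  induction k with
  | zero => exact hf
  | succ k ih =>
    intro x hx
    have hxI : x ∈ Icc a b := ⟨hc.1.trans hx.1.le, hx.2⟩
    rw [Function.iterate_succ_apply', phiDeriv_congr hc.1 (ih (by omega)) hx, phiDeriv,
      (h.hasDerivWithinAt_comp hxI (hF k (by omega) _
        (h.mapsTo ⟨hc.1, hc.2.le⟩ hx))).derivWithin (uniqueDiffOn_Icc h.lt x hxI),
      inv_mul_cancel_left₀ (Complex.ofReal_ne_zero.2 (h.deriv_pos x hxI).ne')]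
    rfl

theorem phiDeriv_iterate_differentiableWithinAt (h : IsChangeOfVariables a b φ)
    (hc : c ∈ Ico a b) {m : ℕ} {F : ℕ → ℝ → ℂ} {f : ℝ → ℂ}
    (hF : ∀ k < m, ∀ y ∈ Ioc (φ c) (φ b),
      HasDerivWithinAt (F k) (F (k + 1) y) (Icc (φ a) (φ b)) y)
    (hf : EqOn f (F 0 ∘ φ) (Ioc c b)) {k : ℕ} (hk : k < m) {x : ℝ} (hx : x ∈ Ioc c b) :
    DifferentiableWithinAt ℝ ((phiDeriv a b φ)^[k] f) (Icc a b) x := by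
  have hxI : x ∈ Icc a b := ⟨hc.1.trans hx.1.le, hx.2⟩
  have h1 := (h.hasDerivWithinAt_comp hxI (hF k hk _
    (h.mapsTo ⟨hc.1, hc.2.le⟩ hx))).differentiableWithinAt
  have h2 := h.phiDeriv_iterate_eqOn hc hF hf hk.le
  refine h1.congr_of_eventuallyEq ?_ (h2 hx)
  rw [nhdsWithin_Icc_eq_of_lt hc.1 hx.1]
  exact h2.eventuallyEq_nhdsWithin

end IsChangeOfVariables

/-! ### Regularity of `u` as a function of `φ x` -/

theorem contDiffOn_phiDeriv {a b : ℝ} (hab : a < b) {φ : ℝ → ℝ}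
    (hφ' : ∀ x ∈ Icc a b, 0 < derivWithin φ (Icc a b) x) {n : ℕ}
    (hφ : ContDiffOn ℝ (n + 1 : ℕ) φ (Icc a b)) {f : ℝ → ℂ}
    (hf : ContDiffOn ℝ (n + 1 : ℕ) f (Ioc a b)) : ContDiffOn ℝ n (phiDeriv a b φ f) (Ioc a b) := by
  have h1 : ContDiffOn ℝ n (derivWithin φ (Icc a b)) (Icc a b) :=
    hφ.derivWithin (uniqueDiffOn_Icc hab) (by norm_cast)
  have h2 : ContDiffOn ℝ n (fun x => ((derivWithin φ (Icc a b) x : ℝ) : ℂ)) (Icc a b) :=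
    Complex.ofRealCLM.contDiff.comp_contDiffOn h1
  have h3 := h2.inv fun x hx => Complex.ofReal_ne_zero.2 (hφ' x hx).ne'
  have h4 : ContDiffOn ℝ n (derivWithin f (Ioc a b)) (Ioc a b) :=
    hf.derivWithin (uniqueDiffOn_Ioc a b) (by norm_cast)
  refine (h3.mono Ioc_subset_Icc_self).mul (h4.congr fun x hx => ?_)
  -- Smoothness of `f` is known within `(a,b]` only, while `phiDeriv` differentiates within `[a,b]`;
  -- the two agree at points of `(a,b]`.
  have h5 : Ioc a b = Icc a b ∩ Ioi a := by
    ext t; simp only [mem_Ioc, mem_inter_iff, mem_Icc, mem_Ioi]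
    exact ⟨fun ht => ⟨⟨ht.1.le, ht.2⟩, ht.1⟩, fun ht => ⟨ht.2, ht.1.2⟩⟩
  rw [h5, derivWithin_inter (Ioi_mem_nhds hx.1)]

theorem contDiffOn_phiDeriv_iterate {a b : ℝ} (hab : a < b) {φ : ℝ → ℝ}
    (hφ' : ∀ x ∈ Icc a b, 0 < derivWithin φ (Icc a b) x) (k : ℕ) {n : ℕ}
    (hφ : ContDiffOn ℝ (n + k : ℕ) φ (Icc a b)) {f : ℝ → ℂ}
    (hf : ContDiffOn ℝ (n + k : ℕ) f (Ioc a b)) :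
    ContDiffOn ℝ n ((phiDeriv a b φ)^[k] f) (Ioc a b) := by
  induction k generalizing n with
  | zero => exact hf
  | succ k ih =>
    rw [Function.iterate_succ_apply']
    rw [show n + (k + 1) = (n + 1) + k by ring] at hφ hf
    exact contDiffOn_phiDeriv hab hφ' (hφ.of_le (by norm_cast; omega)) (ih hφ hf)

theorem smoothData_phiDeriv {a b : ℝ} (hab : a < b) {φ : ℝ → ℝ} {m : ℕ} (hm : 0 < m)
    (hφ : ContDiffOn ℝ m φ (Icc a b))
    (hφ' : ∀ x ∈ Icc a b, 0 < derivWithin φ (Icc a b) x) {u : ℝ → ℂ}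
    (hu : IntegrableOn u (Icc a b)) (hum : ContDiffOn ℝ m u (Ioc a b)) :
    SmoothData (fun k y => (phiDeriv a b φ)^[k] u (phiInv a b φ y)) m (φ a) (φ b) := by
  have h : IsChangeOfVariables a b φ := ⟨hab, hφ.of_le (by norm_cast), hφ'⟩
  have hmaps : MapsTo (phiInv a b φ) (Ioc (φ a) (φ b)) (Ioc a b) := fun y hy => h.phiInv_mem_Ioc hy
  refine ⟨fun k hk y hy => ?_, ?_, ?_⟩
  · have hy' := Ioc_subset_Icc_self hy
    obtain ⟨n, rfl⟩ : ∃ n, m = (n + 1) + k := ⟨m - 1 - k, by omega⟩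
    have h1 := contDiffOn_phiDeriv_iterate hab hφ' k hφ hum
    have h2 := (h1.differentiableOn (by norm_cast) _ (hmaps hy)).hasDerivWithinAt
    have h3 : HasDerivWithinAt ((phiDeriv a b φ)^[k] u) _ (Icc a b) (phiInv a b φ y) :=
      h2.mono_of_mem_nhdsWithin (by
        rw [nhdsWithin_Icc_eq_of_lt le_rfl (hmaps hy).1]; exact self_mem_nhdsWithin)
    have h4 := h3.scomp y (h.phiInv_hasDerivWithinAt hy') fun z hz => h.phiInv_mem hz
    refine h4.congr_deriv ?_
    rw [Function.iterate_succ_apply', phiDeriv,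
      h3.derivWithin (uniqueDiffOn_Icc hab _ (h.phiInv_mem hy'))]
    simp
  · have h1 : ContDiffOn ℝ (0 : ℕ) ((phiDeriv a b φ)^[m] u) (Ioc a b) :=
      contDiffOn_phiDeriv_iterate hab hφ' m (by simpa using hφ) (by simpa using hum)
    exact h1.continuousOn.comp (h.continuousOn_phiInv.mono Ioc_subset_Icc_self) hmaps
  · have hb := right_mem_Icc.2 hab.le
    have h1 := (h.intervalIntegrable_iff hb fun y => u (phiInv a b φ y)).1 ?_
    · exact (intervalIntegrable_iff_integrableOn_Ioc_of_le
        ((h.strictMonoOn.le_iff_le (left_mem_Icc.2 hab.le) hb).2 hab.le)).1 h1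
    · have h2 : IntervalIntegrable u volume a b :=
        (intervalIntegrable_iff_integrableOn_Icc_of_le hab.le).2 hu
      have h3 := h2.continuousOn_mul
        (g := fun t => ((derivWithin φ (Icc a b) t : ℝ) : ℂ)) (by
          rw [uIcc_of_le hab.le]
          exact Complex.continuous_ofReal.comp_continuousOn h.continuousOn_deriv)
      refine h3.congr fun t ht => ?_
      rw [uIoc_of_le hab.le] at ht
      simp only [h.phiInv_apply (Ioc_subset_Icc_self ht)]

/-! ### The operators of fractional calculus as convolutions -/

theorem convDeriv_const_mul (K v : ℕ → ℝ → ℂ) (p c : ℝ) (k : ℕ) (y : ℝ) (z : ℂ) :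
    convDeriv (fun k r => z * K k r) v p c k y = z * convDeriv K v p c k y := by
  simp only [convDeriv, mul_assoc, intervalIntegral.integral_const_mul, mul_add, Finset.mul_sum]

/-- The derivatives of `u` with respect to `φ`, as functions of `y = φ x`. -/
def phiData (a b : ℝ) (φ : ℝ → ℝ) (u : ℝ → ℂ) (k : ℕ) (y : ℝ) : ℂ :=
  (phiDeriv a b φ)^[k] u (phiInv a b φ y)

namespace IsChangeOfVariables

variable {a b : ℝ} {φ : ℝ → ℝ} {u : ℝ → ℂ} {m : ℕ}

/-- The integrands are compared on the open interval only: at `t = x` the kernel has argument `0`,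
where its series form and its closed form may differ. -/
theorem conv_comp (h : IsChangeOfVariables a b φ) {x : ℝ} (hx : x ∈ Ioc a b) {k G : ℝ → ℂ}
    (hG : ∀ t ∈ Ioo a x,
      G t = ((derivWithin φ (Icc a b) t : ℝ) : ℂ) * (k (φ x - φ t) * u t)) :
    (IntervalIntegrable (fun s => k (φ x - s) * phiData a b φ u 0 s) volume (φ a) (φ x) →
      IntervalIntegrable G volume a x) ∧
    ∫ t in a..x, G t = ∫ s in φ a..φ x, k (φ x - s) * phiData a b φ u 0 s := by
  have hxI := Ioc_subset_Icc_self hx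
  have hae : ∀ᵐ t : ℝ, t ∈ uIoc a x → ((derivWithin φ (Icc a b) t : ℝ) : ℂ) *
      (k (φ x - φ t) * phiData a b φ u 0 (φ t)) = G t := by
    have hne : ∀ᵐ t : ℝ, t ≠ x := by simp [ae_iff]
    filter_upwards [hne] with t ht htI
    rw [uIoc_of_le hx.1.le] at htI
    rw [hG t ⟨htI.1, lt_of_le_of_ne htI.2 ht⟩, phiData, Function.iterate_zero, id,
      h.phiInv_apply ⟨htI.1.le, htI.2.trans hx.2⟩]
  refine ⟨fun hi => ?_, ?_⟩
  · have h1 := (h.intervalIntegrable_iff hxI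
      fun s => k (φ x - s) * phiData a b φ u 0 s).2 hi
    exact h1.congr_ae ((ae_restrict_iff' measurableSet_uIoc).2 hae)
  · rw [← h.integral_comp hxI fun s => k (φ x - s) * phiData a b φ u 0 s]
    exact (intervalIntegral.integral_congr_ae hae).symm

section Conv

variable {K : ℕ → ℝ → ℂ} {ρ c : ℝ} {f : ℝ → ℂ}

theorem eqOn_convDeriv_zero (h : IsChangeOfVariables a b φ)
    (hv : SmoothData (phiData a b φ u) m (φ a) (φ b)) (hK : SmoothKernel K ρ)
    (hρ : φ b - φ a < ρ)
    (hf : ∀ x ∈ Ioc a b, f x = ∫ s in φ a..φ x, K 0 (φ x - s) * phiData a b φ u 0 s)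
    (hc : c ∈ Ioo a b) :
    EqOn f (convDeriv K (phiData a b φ u) (φ a) (φ c) 0 ∘ φ) (Ioc c b) := by
  intro x hx
  rw [hf x ⟨hc.1.trans hx.1, hx.2⟩, Function.comp_apply, hK.convDeriv_zero hv hρ
    (h.strictMonoOn (left_mem_Icc.2 h.lt.le) (Ioo_subset_Icc_self hc) hc.1)
    (h.mapsTo (Ioo_subset_Icc_self hc) hx)]

theorem phiDeriv_iterate_conv (h : IsChangeOfVariables a b φ)
    (hv : SmoothData (phiData a b φ u) m (φ a) (φ b)) (hK : SmoothKernel K ρ)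
    (hρ : φ b - φ a < ρ)
    (hf : ∀ x ∈ Ioc a b, f x = ∫ s in φ a..φ x, K 0 (φ x - s) * phiData a b φ u 0 s)
    (hc : c ∈ Ioo a b) {k : ℕ} (hk : k ≤ m) :
    EqOn ((phiDeriv a b φ)^[k] f) (convDeriv K (phiData a b φ u) (φ a) (φ c) k ∘ φ)
      (Ioc c b) :=
  h.phiDeriv_iterate_eqOn ⟨hc.1.le, hc.2⟩
    (fun _ hk _ hy => hK.convDeriv_hasDerivWithinAt hv hρ
      (h.strictMonoOn (left_mem_Icc.2 h.lt.le) (Ioo_subset_Icc_self hc) hc.1) hk hy)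
    (h.eqOn_convDeriv_zero hv hK hρ hf hc) hk

theorem phiDifferentiable_conv (h : IsChangeOfVariables a b φ)
    (hv : SmoothData (phiData a b φ u) m (φ a) (φ b)) (hK : SmoothKernel K ρ)
    (hρ : φ b - φ a < ρ)
    (hf : ∀ x ∈ Ioc a b, f x = ∫ s in φ a..φ x, K 0 (φ x - s) * phiData a b φ u 0 s)
    {j : ℕ} (hj : j ≤ m) : PhiDifferentiable a b φ j f := by
  intro k hk x hx
  -- The cut `c` is auxiliary: every point of `(a,b]` has one to its left.
  obtain ⟨c, hc1, hc2⟩ := exists_between hx.1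
  have hc : c ∈ Ioo a b := ⟨hc1, hc2.trans_le hx.2⟩
  exact (h.phiDeriv_iterate_differentiableWithinAt ⟨hc.1.le, hc.2⟩
    (fun _ hk _ hy => hK.convDeriv_hasDerivWithinAt hv hρ
      (h.strictMonoOn (left_mem_Icc.2 h.lt.le) (Ioo_subset_Icc_self hc) hc.1) hk hy)
    (h.eqOn_convDeriv_zero hv hK hρ hf hc) (hk.trans_le hj) ⟨hc2, hx.2⟩).mono Ioc_subset_Icc_self

end Conv

/-! ### Riemann–Liouville integrals and their derivatives -/

theorem rlIntegral_eq_conv (h : IsChangeOfVariables a b φ) (γ : ℂ) {x : ℝ} (hx : x ∈ Ioc a b) :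
    rlIntegral a b φ γ u x = ∫ s in φ a..φ x,
      (Complex.Gamma γ)⁻¹ * powKernel γ 0 (φ x - s) * phiData a b φ u 0 s := by
  rw [rlIntegral, (h.conv_comp hx (u := u) (k := powKernel γ 0)
    (G := rlIntegrand a b φ γ u x) fun t _ => by rw [rlIntegrand, powKernel_zero, mul_assoc]).2]
  simp only [mul_assoc, intervalIntegral.integral_const_mul]

theorem rlIntegrand_intervalIntegrable (h : IsChangeOfVariables a b φ)
    (hv : SmoothData (phiData a b φ u) m (φ a) (φ b)) {γ : ℂ} (hγ : 0 < γ.re) {x : ℝ}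
    (hx : x ∈ Ioc a b) : IntervalIntegrable (rlIntegrand a b φ γ u x) volume a x :=
  (h.conv_comp hx (k := powKernel γ 0)
    fun t _ => by rw [rlIntegrand, powKernel_zero, mul_assoc]).1
    ((smoothKernel_powKernel hγ _).conv_intervalIntegrable hv (lt_add_one (φ b - φ a))
      (h.mapsTo (left_mem_Icc.2 h.lt.le) hx))

/-- The kernel `r^γ / Γ(γ+1)` vanishes at `0` and its derivative `r^(γ-1) / Γ(γ)` is integrable, so
`convDeriv_one` applies. -/
theorem phiDeriv_rlIntegral (h : IsChangeOfVariables a b φ)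
    (hv : SmoothData (phiData a b φ u) m (φ a) (φ b)) (hm : 0 < m) {γ : ℂ} (hγ : 0 < γ.re) :
    EqOn (phiDeriv a b φ (rlIntegral a b φ (γ + 1) u)) (rlIntegral a b φ γ u) (Ioc a b) := by
  intro x hx
  obtain ⟨c, hc1, hc2⟩ := exists_between hx.1
  have hc : c ∈ Ioo a b := ⟨hc1, hc2.trans_le hx.2⟩
  have hγ1 : 0 < (γ + 1).re := by simp; linarith
  have hγ0 : γ ≠ 0 := by rintro rfl; simp at hγ
  have hρ := lt_add_one (φ b - φ a)
  have h1 := h.phiDeriv_iterate_conv hv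
    ((smoothKernel_powKernel hγ1 _).const_mul (Complex.Gamma (γ + 1))⁻¹) hρ
    (fun x hx => h.rlIntegral_eq_conv (γ + 1) hx) hc (Nat.succ_le_of_lt hm)
    ⟨hc2, hx.2⟩
  rw [Function.iterate_one, Function.comp_apply, convDeriv_const_mul,
    (smoothKernel_powKernel hγ1 _).convDeriv_one (smoothKernel_powKernel_succ hγ _)
      (powKernel_succ_continuous hγ).continuousOn (powKernel_succ_zero hγ) hv hm hρ
      (h.strictMonoOn (left_mem_Icc.2 h.lt.le) (Ioo_subset_Icc_self hc) hc.1)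
      (h.mapsTo (Ioo_subset_Icc_self hc) ⟨hc2, hx.2⟩)] at h1
  rw [h1, h.rlIntegral_eq_conv γ hx, Complex.Gamma_add_one γ hγ0]
  have h2 : powKernel (γ + 1) 1 = fun r => γ * powKernel γ 0 r := by
    funext r; exact powKernel_succ γ 0 r
  simp only [h2, mul_assoc, intervalIntegral.integral_const_mul, mul_inv]
  field_simp

theorem phiDeriv_iterate_rlIntegral (h : IsChangeOfVariables a b φ)
    (hv : SmoothData (phiData a b φ u) m (φ a) (φ b)) (hm : 0 < m) {γ : ℂ} (hγ : 0 < γ.re)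
    (j : ℕ) :
    EqOn ((phiDeriv a b φ)^[j] (rlIntegral a b φ (γ + j) u)) (rlIntegral a b φ γ u)
      (Ioc a b) := by
  induction j with
  | zero => intro x _; simp
  | succ j ih =>
    rw [Function.iterate_succ]
    have h1 := h.phiDeriv_rlIntegral hv hm (γ := γ + j) (by simp; positivity)
    rw [add_assoc] at h1
    push_cast
    exact (phiDeriv_iterate_congr le_rfl h1 j).trans ih

/-- Makes the number of derivatives the same for all terms of the series. Passing from the order in
the definition to `m` raises the order of the integral by the same integer; for `Re δ < 0` all `m`
derivatives cancel. -/
theorem phiDeriv_iterate_rlIntegral_eq_rlDeriv (h : IsChangeOfVariables a b φ)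
    (hv : SmoothData (phiData a b φ u) m (φ a) (φ b)) (hm : 0 < m) {δ : ℂ}
    (hδ : 0 ≤ δ.re → derivOrder δ ≤ m) :
    EqOn ((phiDeriv a b φ)^[m] (rlIntegral a b φ (m - δ) u)) (rlDeriv a b φ δ u) (Ioc a b) := by
  unfold rlDeriv
  split_ifs with h0
  · obtain ⟨j, rfl⟩ := Nat.exists_eq_add_of_le (hδ h0)
    rw [Function.iterate_add]
    refine phiDeriv_iterate_congr le_rfl ?_ _
    have h1 := h.phiDeriv_iterate_rlIntegral hv hm (γ := (derivOrder δ : ℂ) - δ) (by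
      have := Nat.lt_floor_add_one δ.re
      simpa [derivOrder] using this) j
    rwa [show ((derivOrder δ + j : ℕ) : ℂ) - δ = (derivOrder δ : ℂ) - δ + j by push_cast; ring]
  · rw [show (m : ℂ) - δ = -δ + m by ring]
    exact h.phiDeriv_iterate_rlIntegral hv hm (by simpa using h0) m

theorem rlDerivExists (h : IsChangeOfVariables a b φ)
    (hv : SmoothData (phiData a b φ u) m (φ a) (φ b)) {δ : ℂ}
    (hδ : 0 ≤ δ.re → derivOrder δ ≤ m) : RlDerivExists a b φ δ u := by
  unfold RlDerivExists
  split_ifs with h0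
  · have hpos : 0 < ((derivOrder δ : ℂ) - δ).re := by
      have := Nat.lt_floor_add_one δ.re
      simpa [derivOrder] using this
    exact ⟨fun x hx => h.rlIntegrand_intervalIntegrable hv hpos hx,
      h.phiDifferentiable_conv hv
        ((smoothKernel_powKernel hpos _).const_mul (Complex.Gamma ((derivOrder δ : ℂ) - δ))⁻¹)
        (lt_add_one _) (fun x hx => h.rlIntegral_eq_conv _ hx) (hδ h0)⟩
  · exact fun x hx => h.rlIntegrand_intervalIntegrable hv (by simpa using h0) hx

/-! ### The generalised integral and its term-by-term derivatives -/

section Gen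

variable {B : PowerSeries ℂ} {γ β : ℂ}

theorem genIntegrand_eq (h : IsChangeOfVariables a b φ) {x : ℝ} (hx : x ∈ Ioc a b) :
    ∀ t ∈ Ioo a x, genIntegrand a b φ B γ β u x t =
      ((derivWithin φ (Icc a b) t : ℝ) : ℂ) * (seriesKernel B γ β 0 (φ x - φ t) * u t) := by
  intro t ht
  have hpos : 0 < φ x - φ t := sub_pos.2
    (h.strictMonoOn ⟨ht.1.le, ht.2.le.trans hx.2⟩ (Ioc_subset_Icc_self hx) ht.2)
  rw [seriesKernel_zero B γ β hpos, genIntegrand]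
  ring

theorem genIntegral_eq_conv (h : IsChangeOfVariables a b φ) {x : ℝ} (hx : x ∈ Ioc a b) :
    genIntegral a b φ B γ β u x =
      ∫ s in φ a..φ x, seriesKernel B γ β 0 (φ x - s) * phiData a b φ u 0 s :=
  (h.conv_comp hx (h.genIntegrand_eq hx)).2

theorem genIntegrand_intervalIntegrable (h : IsChangeOfVariables a b φ)
    (hv : SmoothData (phiData a b φ u) m (φ a) (φ b)) {ρ : ℝ} (hρ : φ b - φ a < ρ)
    (hK : SmoothKernel (seriesKernel B γ β) ρ) {x : ℝ} (hx : x ∈ Ioc a b) :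
    IntervalIntegrable (genIntegrand a b φ B γ β u x) volume a x :=
  (h.conv_comp hx (h.genIntegrand_eq hx)).1
    (hK.conv_intervalIntegrable hv hρ (h.mapsTo (left_mem_Icc.2 h.lt.le) hx))

theorem hasSumLocallyUniformlyOn_phiDeriv_genIntegral (h : IsChangeOfVariables a b φ)
    (hv : SmoothData (phiData a b φ u) m (φ a) (φ b)) {ρ : ℝ} (hρ : φ b - φ a < ρ)
    (hK : KernelSeries (seriesTerm B γ β) (seriesKernel B γ β) (φ b - φ a) ρ)
    (hγ : 0 < γ.re) (hβ : 0 < β.re) :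
    HasSumLocallyUniformlyOn
      (fun (n : ℕ) (x : ℝ) => PowerSeries.coeff n B * Complex.Gamma (γ + β * n) *
        (phiDeriv a b φ)^[m] (rlIntegral a b φ (γ + β * n) u) x)
      ((phiDeriv a b φ)^[m] (genIntegral a b φ B γ β u)) (Ioc a b) := by
  refine hasSumLocallyUniformlyOn_of_of_forall_exists_nhds fun x hx => ?_
  -- With `a < c < c' < x`, the integrals are cut at `φ c` and convergence is uniform on the
  -- neighbourhood `[c',b]` of `x` in `(a,b]`.
  obtain ⟨c', hac', hc'x⟩ := exists_between hx.1
  obtain ⟨c, hac, hcc'⟩ := exists_between hac'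
  have hc'b : c' < b := hc'x.trans_le hx.2
  have hc : c ∈ Ioo a b := ⟨hac, hcc'.trans hc'b⟩
  have ha := left_mem_Icc.2 h.lt.le
  have hb := right_mem_Icc.2 h.lt.le
  have hcI := Ioo_subset_Icc_self hc
  have hc'I : c' ∈ Icc a b := ⟨hac'.le, hc'b.le⟩
  refine ⟨Icc c' b, ?_, ?_⟩
  · filter_upwards [self_mem_nhdsWithin, mem_nhdsWithin_of_mem_nhds (Ioi_mem_nhds hc'x)]
      with t ht ht' using ⟨(mem_Ioi.1 ht').le, ht.2⟩
  have h1 := hasSumUniformlyOn_iff_tendstoUniformlyOn.1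
    (hK.convDeriv_hasSumUniformlyOn hρ hv (h.strictMonoOn ha hcI hac)
      (h.strictMonoOn hcI hc'I hcc') (h.strictMonoOn hc'I hb hc'b).le)
  have hmaps : Icc c' b ⊆ φ ⁻¹' Icc (φ c') (φ b) := fun t ht =>
    have htI : t ∈ Icc a b := ⟨hac'.le.trans ht.1, ht.2⟩
    ⟨(h.strictMonoOn.le_iff_le hc'I htI).2 ht.1, (h.strictMonoOn.le_iff_le htI hb).2 ht.2⟩
  have hsub : Icc c' b ⊆ Ioc c b := fun t ht => ⟨hcc'.trans_le ht.1, ht.2⟩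
  refine hasSumUniformlyOn_iff_tendstoUniformlyOn.2
    ((((h1.comp φ).mono hmaps).congr (Eventually.of_forall fun S t ht => ?_)).congr_right
      fun t ht => ?_)
  · simp only [Function.comp_apply]
    refine Finset.sum_congr rfl fun n _ => ?_
    have hn := re_add_mul_natCast_pos hγ hβ n
    rw [h.phiDeriv_iterate_conv hv
      ((smoothKernel_powKernel hn _).const_mul (Complex.Gamma (γ + β * n))⁻¹) hρ
      (fun x hx => h.rlIntegral_eq_conv _ hx) hc le_rfl (hsub ht), Function.comp_apply,
      convDeriv_const_mul, mul_assoc,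
      mul_inv_cancel_left₀ (Complex.Gamma_ne_zero_of_re_pos hn), ← convDeriv_const_mul]
    rfl
  · exact (h.phiDeriv_iterate_conv hv hK.smooth_sum hρ
      (fun x hx => h.genIntegral_eq_conv hx) hc le_rfl (hsub ht)).symm

end Gen

end IsChangeOfVariables

end AnalyticKernelCalculus

end

/-! ### Proof of the theorem -/

open AnalyticKernelCalculus in
theorem mainTheorem5 (a b : ℝ) (hab : a < b) (α β : ℂ) (hα : 0 ≤ α.re) (hα0 : α ≠ 0)
    (hβ : 0 < β.re) (m : ℕ) (hm : m = ⌊α.re⌋₊ + 1)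
    (φ : ℝ → ℝ) (hφ : ContDiffOn ℝ m φ (Set.Icc a b))
    (hφ' : ∀ x ∈ Set.Icc a b, 0 < derivWithin φ (Set.Icc a b) x)
    (R : ℝ) (hR : (φ b - φ a) ^ β.re < R)
    (A : PowerSeries ℂ) (hA : ConvergesOnDisc A R) (hA0 : PowerSeries.constantCoeff A ≠ 0)
    (hAbar : ConvergesOnDisc (conjKernel α β A) R)
    (u : ℝ → ℂ) (hu : MeasureTheory.IntegrableOn u (Set.Icc a b))
    (hum : ContDiffOn ℝ m u (Set.Ioc a b)) :
    GenDerivExists a b φ A α β u ∧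
    (∀ n : ℕ, RlDerivExists a b φ (α - β * n) u) ∧
    HasSumLocallyUniformlyOn
      (fun (n : ℕ) (x : ℝ) =>
        PowerSeries.coeff n (conjKernel α β A) * Complex.Gamma (β * n - α + m) *
          rlDeriv a b φ (α - β * n) u x)
      (genDeriv a b φ A α β u) (Set.Ioc a b) := by
  change m = derivOrder α at hm
  subst hm
  have hm0 : 0 < derivOrder α := Nat.succ_pos _
  have hγ : 0 < ((derivOrder α : ℂ) - α).re := by
    have := Nat.lt_floor_add_one α.re
    simpa [derivOrder] using this
  have h : IsChangeOfVariables a b φ := ⟨hab, hφ.of_le (by norm_cast), hφ'⟩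
  have hv : SmoothData (phiData a b φ u) (derivOrder α) (φ a) (φ b) :=
    smoothData_phiDeriv hab hm0 hφ hφ' hu hum
  -- Subtracting `β n` does not raise the real part, so no term needs more than the `m` available
  -- derivatives of `u`.
  have hδ : ∀ n : ℕ, 0 ≤ (α - β * n).re → derivOrder (α - β * n) ≤ derivOrder α := by
    intro n _
    refine Nat.succ_le_succ (Nat.floor_mono ?_)
    have : 0 ≤ β.re * n := by positivity
    simpa using this
  obtain ⟨ρ, hρ, hK⟩ := exists_kernelSeries hAbar hγ hβ (sub_pos.2
    (h.strictMonoOn (Set.left_mem_Icc.2 hab.le) (Set.right_mem_Icc.2 hab.le) hab)) hR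
  refine ⟨⟨fun x hx => h.genIntegrand_intervalIntegrable hv hρ hK.smooth_sum hx,
    h.phiDifferentiable_conv hv hK.smooth_sum hρ (fun x hx => h.genIntegral_eq_conv hx) le_rfl⟩,
    fun n => h.rlDerivExists hv (hδ n), ?_⟩
  refine TendstoLocallyUniformlyOn.congr
    (h.hasSumLocallyUniformlyOn_phiDeriv_genIntegral hv hρ hK hγ hβ) fun S x hx =>
      Finset.sum_congr rfl fun n _ => ?_
  dsimp only
  rw [← h.phiDeriv_iterate_rlIntegral_eq_rlDeriv hv hm0 (hδ n) hx,
    show β * n - α + (derivOrder α : ℂ) = (derivOrder α : ℂ) - α + β * n by ring,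
    show (derivOrder α : ℂ) - (α - β * n) = (derivOrder α : ℂ) - α + β * n by ring]
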